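/- Let $X$ be a finite set and let $L$ be the generator of a Markov process $(x_t)$ on $X$ with almost surely finite lifetime $\zeta$ (the process is sent to a cemetery at $\zeta$): $L$ is a real $X\times X$ matrix with nonnegative off-diagonal entries and nonpositive row sums, the transition probabilities are $P_t=e^{tL}$, and $\mathbb P_x(\zeta>t)=\sum_y P_t(x,y)\to0$ as $t\to\infty$ for every $x$. No symmetry is assumed. Let $V=(-L)^{-1}$, let $\mu$ be a probability on $X$ from whose support every point of $X$ can be reached by the process (this is automatic if the process is irreducible), and let $m=\mu V$, that is, $m_y=\sum_x\mu_xV_{x,y}$. Write $M_f$ for the diagonal matrix with coefficients $f$, $\langle f,g\rangle_m=\sum_x f_xg_xm_x$, and let $$\nu_X(dz)=\frac{1}{(2\pi)^{|X|}}\det(-M_mL)\,e^{\frac12\langle Lz,\bar z\rangle_m}\prod_{u\in X}dx_u\,dy_u,\qquad z=(x_u+iy_u)_{u\in X}\in\mathbb C^X,$$ the normalized twisted Gaussian measure, which is a complex measure on $\mathbb C^X$. Then: (1) The image $Q$ of $\nu_X$ under the map $z\mapsto\rho=(\tfrac12z_u\bar z_u)_{u\in X}$ is an infinitely divisible probability measure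 on $\mathbb R_+^X$. (2) Its Laplace transform is $\int e^{-\langle s,\rho\rangle_m}\,Q(d\rho)=\Phi(s):=\dfrac{\det(-L)}{\det(-L+M_s)}$ for $s\in\mathbb R_+^X$, and $\Phi$ is completely monotone on $\mathbb R_+^X$: it is smooth there and all its partial derivatives of order $n$ have the sign of $(-1)^n$ in the weak sense, for every $n\ge0$. (3) For every right-continuous Markov process with generator $L$, let $l_t^u=\int_0^{t\wedge\zeta}1_{\{x_s=u\}}\frac{ds}{m_u}$ and define the path measure $\mathbb E_{x,y}$ by $\mathbb E_{x,y}(G)=\mathbb E_x\big(\int_0^\zeta G(x_s,s\le t)\,dl_t^y\big)$; under $\mathbb E_{x,y}$, $l$ denotes the local time of the whole path, that is, $l=l_t$ for the path $(x_s,s\le t)$. Then for every $x\in X$ and every continuous function $F$ on $\mathbb R_+^X$, $$(**)\qquad\int\rho_x\,F(\rho)\,Q(d\rho)=\int\mathbb E_{x,x}\big(F(l+\rho)\big)\,Q(d\rho).$$ This holds in $[0,\infty]$ if $F\ge0$. If $F$ is real- or complex-valued, then $\rho\mapsto\rho_xF(\rho)$ is $Q$-integrable if and only if $F(l+\rho)$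 is integrable with respect to $Q\otimes\mathbb E_{x,x}$, and $(**)$ holds whenever this is the case. -/

import Mathlib

open MeasureTheory Filter Topology
open scoped NNReal

noncomputable section

namespace Dynkin

variable {X : Type*} [Fintype X] [DecidableEq X]

/-- The generator `L` of a (possibly killed) continuous-time Markov process on the finite
space `X`: `L = q (Π - I)` with `q` positive and `Π` submarkovian. -/
structure IsSubMarkovGenerator (L : Matrix X X ℝ) : Prop where
  offDiag_nonneg : ∀ x y, x ≠ y → 0 ≤ L x y
  rowSum_nonpos : ∀ x, ∑ y, L x y ≤ 0

/-- The transition function `P_t(x, y) = (e^{tL})_{x, y}`. -/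
def semigroup (L : Matrix X X ℝ) (t : ℝ) : Matrix X X ℝ :=
  NormedSpace.exp (t • L)

/-- The lifetime `ζ` is almost surely finite from every starting point: the survival probability
`ℙ_x(ζ > t) = ∑ y, P_t(x, y)` tends to `0` as `t → ∞`. -/
def HasFiniteLifetime (L : Matrix X X ℝ) : Prop :=
  ∀ x, Tendsto (fun t : ℝ => ∑ y, semigroup L t x y) atTop (𝓝 0)

/-- The process started at `y` can reach `x`, through jumps of positive rate. -/
def Reaches (L : Matrix X X ℝ) (y x : X) : Prop :=
  Relation.ReflTransGen (fun a b => 0 < L a b) y x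

/-- The potential `V = (-L)⁻¹`. -/
def potential (L : Matrix X X ℝ) : Matrix X X ℝ := (-L)⁻¹

/-- The reference measure `m = μ V`. -/
def refMeasure (L : Matrix X X ℝ) (μ : X → ℝ) : X → ℝ :=
  Matrix.vecMul μ (potential L)

/-- The form `⟨Lz, z̄⟩_m = ∑ x, (Lz)_x z̄_x m_x`, complex-valued when `L` is not `m`-symmetric. -/
def energy (L : Matrix X X ℝ) (m : X → ℝ) (z : X → ℂ) : ℂ :=
  ∑ x, (∑ y, (L x y : ℂ) * z y) * (starRingEnd ℂ) (z x) * (m x : ℂ)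

/-- The density `(2π)^{-|X|} det(-M_m L) e^{½⟨Lz, z̄⟩_m}`. -/
def twistedGaussianDensity (L : Matrix X X ℝ) (m : X → ℝ) (z : X → ℂ) : ℂ :=
  ((((2 * Real.pi) ^ Fintype.card X)⁻¹ * (-(Matrix.diagonal m * L)).det : ℝ) : ℂ)
    * Complex.exp ((1 / 2 : ℂ) * energy L m z)

/-- The normalized twisted Gaussian measure `ν_X`, a complex measure on `ℂ^X`; the reference
measure `volume` is Lebesgue measure `∏ u, dx_u dy_u`. -/
def twistedGaussian (L : Matrix X X ℝ) (m : X → ℝ) : ComplexMeasure (X → ℂ) :=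
  (volume : Measure (X → ℂ)).withDensityᵥ (twistedGaussianDensity L m)

/-- The map `z ↦ ρ = ½ z z̄` from `ℂ^X` to `ℝ_+^X`. -/
def halfSq (z : X → ℂ) : X → ℝ≥0 := fun u => ‖z u‖₊ ^ 2 / 2

/-- Infinite divisibility: for every `n ≥ 1`, `Q` is the law of a sum of `n` independent
identically distributed random elements. -/
def IsInfinitelyDivisible {M : Type*} [AddCommMonoid M] [MeasurableSpace M]
    (Q : Measure M) : Prop :=
  ∀ n : ℕ, 0 < n → ∃ R : Measure M, IsProbabilityMeasure R ∧
    (Measure.pi (fun _ : Fin n => R)).map (fun v => ∑ i, v i) = Q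

/-- The function `Φ(s) = det(-L) / det(-L + M_s)`. -/
def laplaceRatio (L : Matrix X X ℝ) (s : X → ℝ) : ℝ :=
  (-L).det / (-L + Matrix.diagonal s).det

/-- Complete monotonicity on the closed orthant `ℝ_+^X`: the function is smooth there and its
derivatives of order `n` in nonnegative directions (equivalently, its partial derivatives of
order `n`) have the sign of `(-1)^n`. -/
def IsCompletelyMonotone (f : (X → ℝ) → ℝ) : Prop :=
  ContDiffOn ℝ ((⊤ : ℕ∞) : WithTop ℕ∞) f (Set.Ici 0) ∧
    ∀ (n : ℕ) (s : X → ℝ) (v : Fin n → X → ℝ), 0 ≤ s → (∀ i, 0 ≤ v i) →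
      0 ≤ (-1) ^ n * iteratedFDerivWithin ℝ n f (Set.Ici 0) s v

/-- `ξ` is, under the family of laws `P x` (`x` is the starting point), a Markov process on `X`
with generator `L`, right-continuous paths and cemetery `none`. Only times `t ≥ 0` matter. -/
structure IsMarkovProcess (L : Matrix X X ℝ) {Ω : Type*} [MeasurableSpace Ω]
    (P : X → Measure Ω) (ξ : ℝ → Ω → Option X) : Prop where
  isProbabilityMeasure : ∀ x, IsProbabilityMeasure (P x)
  measurableSet_eq : ∀ t, 0 ≤ t → ∀ y, MeasurableSet {ω | ξ t ω = some y}
  rightCont : ∀ ω t, 0 ≤ t → ∀ᶠ s in 𝓝[≥] t, ξ s ω = ξ t ω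
  absorbing : ∀ ω s t, 0 ≤ s → s ≤ t → ξ s ω = none → ξ t ω = none
  finiteDimensional : ∀ (x : X) (n : ℕ) (t : ℕ → ℝ) (y : ℕ → X),
    Monotone t → t 0 = 0 → y 0 = x →
      P x {ω | ∀ i ≤ n, ξ (t i) ω = some (y i)} =
        ENNReal.ofReal
          (∏ i ∈ Finset.range n, semigroup L (t (i + 1) - t i) (y i) (y (i + 1)))

/-- The local time `l_t^u = ∫_0^{t ∧ ζ} 1_{ξ_s = u} m_u⁻¹ ds` (nothing is accumulated after `ζ`,
where `ξ = none`). -/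
def localTime {Ω : Type*} (m : X → ℝ) (ξ : ℝ → Ω → Option X) (ω : Ω) (t : ℝ) : X → ℝ≥0 :=
  fun u => Real.toNNReal ((m u)⁻¹ * volume.real {s : ℝ | 0 ≤ s ∧ s ≤ t ∧ ξ s ω = some u})

/-- The path measure `𝔼_{x,y}`, defined by
`𝔼_{x,y}(G) = 𝔼_x (∫_0^ζ G(ξ_s, s ≤ t) dl_t^y)` with `dl_t^y = m_y⁻¹ 1_{ξ_t = y} dt`, as a measure
on pairs `(ω, t)`; the pair stands for the path `(ξ_s(ω), s ≤ t)` of duration `t`. -/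
def pathMeasure {Ω : Type*} [MeasurableSpace Ω] (m : X → ℝ) (P : X → Measure Ω)
    (ξ : ℝ → Ω → Option X) (x y : X) : Measure (Ω × ℝ) :=
  ENNReal.ofReal (m y)⁻¹ •
    ((P x).prod volume).restrict {p : Ω × ℝ | 0 ≤ p.2 ∧ ξ p.2 p.1 = some y}

end Dynkin

end

open Dynkin

/-! Everything rests on Laplace transforms: a finite measure on the orthant is determined by its
integrals against `laplaceKernel` (`ext_of_laplaceTransform`), so each measure identity reduces to
an identity between functions of `s`.

Existence and infinite divisibility of `Q` do not come from the Gaussian measure, which is not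
positive in general. For `q` large, `1 + L/q` has nonnegative entries, and `-L + M_s = M_{q+s} (1 -
A_s)` with `A_s = M_{q/(q+s)} (1 + L/q)`. Expanding `log det (1 - A_s)` in traces gives `Φ(s) = ∏
q/(q+s_x) · exp (∑ tr(A_s^k)/k - ∑ tr(A_0^k)/k)`. The n-th root has the same shape, with the powers
`(q/(q+s_x))^{1/n}` and the factor `1/n` in the exponent. It is built from transforms of gamma laws
and nonnegative constants by sums, products and exponentials, hence is the transform of a positive
measure (`exists_isLaplace_pow_eq`). The case `n = 1` yields `Q`, the other `n` yield its
convolution roots.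

The twisted Gaussian integral can be computed because `mL = -μ ≤ 0` makes the symmetric part of `-L`
in `ℓ²(m)` a Dirichlet form, which is definite by the reachability hypothesis (`sum_mul_sum_pos`).
Its image under `halfSq` therefore has transform `Φ` (`integral_twistedGaussianDensity_mul`) and
equals `Q`.

For `(**)`, write `R_s = (-L + M_s)⁻¹`. The measure `ρ_x Q(dρ)` has transform `-m_x⁻¹ ∂Φ/∂s_x = Φ(s)
m_x⁻¹ R_s(x,x)`, while the Feynman–Kac formula gives `𝔼_{x,x}(e^{-⟨s,l⟩_m}) = m_x⁻¹ R_s(x,x)`. The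
law of `l + ρ` has the product of transforms, so the two measures coincide
(`withDensity_eq_map_localTime_add`).

Complete monotonicity is algebraic: polynomials with nonnegative coefficients in `Φ` and the entries
of `R_s` are stable under minus a derivative in a nonnegative direction. -/

noncomputable section

namespace Dynkin

open scoped ENNReal BoundedContinuousFunction

/-! ### Laplace transforms of measures on the orthant. -/

section Laplace

variable {X : Type*} [Fintype X]

/-- The function `ρ ↦ e^{-⟨s, ρ⟩_m}`. -/
def laplaceKernel (m s : X → ℝ) (ρ : X → ℝ≥0) : ℝ :=
  Real.exp (-∑ x, s x * (ρ x : ℝ) * m x)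

@[fun_prop]
lemma continuous_laplaceKernel (m s : X → ℝ) : Continuous (laplaceKernel m s) := by
  unfold laplaceKernel
  fun_prop

@[fun_prop]
lemma measurable_laplaceKernel (m s : X → ℝ) : Measurable (laplaceKernel m s) :=
  (continuous_laplaceKernel m s).measurable

lemma laplaceKernel_pos (m s : X → ℝ) (ρ : X → ℝ≥0) : 0 < laplaceKernel m s ρ :=
  Real.exp_pos _

lemma laplaceKernel_le_one {m s : X → ℝ} (hm : ∀ x, 0 < m x) (hs : 0 ≤ s) (ρ : X → ℝ≥0) :
    laplaceKernel m s ρ ≤ 1 := by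
  unfold laplaceKernel
  rw [Real.exp_le_one_iff, neg_nonpos]
  exact Finset.sum_nonneg fun x _ =>
    mul_nonneg (mul_nonneg (hs x) (ρ x).coe_nonneg) (hm x).le

lemma laplaceKernel_add_left (m s t : X → ℝ) (ρ : X → ℝ≥0) :
    laplaceKernel m (s + t) ρ = laplaceKernel m s ρ * laplaceKernel m t ρ := by
  unfold laplaceKernel
  rw [← Real.exp_add, ← neg_add, ← Finset.sum_add_distrib]
  congr 2
  exact Finset.sum_congr rfl fun x _ => by simp only [Pi.add_apply]; ring

lemma laplaceKernel_add_right (m s : X → ℝ) (ρ σ : X → ℝ≥0) :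
    laplaceKernel m s (ρ + σ) = laplaceKernel m s ρ * laplaceKernel m s σ := by
  unfold laplaceKernel
  rw [← Real.exp_add, ← neg_add, ← Finset.sum_add_distrib]
  congr 2
  exact Finset.sum_congr rfl fun x _ => by simp only [Pi.add_apply, NNReal.coe_add]; ring

@[simp]
lemma laplaceKernel_zero_left (m : X → ℝ) (ρ : X → ℝ≥0) : laplaceKernel m 0 ρ = 1 := by
  simp [laplaceKernel]

@[simp]
lemma laplaceKernel_zero_right (m s : X → ℝ) : laplaceKernel m s 0 = 1 := by
  simp [laplaceKernel]

lemma integrable_laplaceKernel {m s : X → ℝ} (hm : ∀ x, 0 < m x) (hs : 0 ≤ s)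
    (M : Measure (X → ℝ≥0)) [IsFiniteMeasure M] : Integrable (laplaceKernel m s) M := by
  refine Integrable.of_bound (by fun_prop) 1 (ae_of_all _ fun ρ => ?_)
  rw [Real.norm_of_nonneg (laplaceKernel_pos m s ρ).le]
  exact laplaceKernel_le_one hm hs ρ

/-- The Laplace transform of a measure on the orthant. -/
def laplaceTransform (m : X → ℝ) (M : Measure (X → ℝ≥0)) (s : X → ℝ) : ℝ≥0∞ :=
  ∫⁻ ρ, ENNReal.ofReal (laplaceKernel m s ρ) ∂M

lemma integral_laplaceKernel (m s : X → ℝ) (M : Measure (X → ℝ≥0)) :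
    ∫ ρ, laplaceKernel m s ρ ∂M = (laplaceTransform m M s).toReal :=
  integral_eq_lintegral_of_nonneg_ae (ae_of_all _ fun ρ => (laplaceKernel_pos m s ρ).le)
    (by fun_prop)

/-- The exponentials, as a submonoid of the bounded continuous functions. -/
def laplaceSubmonoid (m : X → ℝ) : Submonoid ((X → ℝ≥0) →ᵇ ℝ) where
  carrier := {f | ∃ s : X → ℝ, 0 ≤ s ∧ ∀ ρ, f ρ = laplaceKernel m s ρ}
  one_mem' := ⟨0, le_rfl, fun ρ => by simp⟩
  mul_mem' := by
    rintro f g ⟨s, hs, hf⟩ ⟨t, ht, hg⟩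
    exact ⟨s + t, add_nonneg hs ht, fun ρ => by simp [hf, hg, laplaceKernel_add_left]⟩

/-- A finite measure on the orthant is determined by its Laplace transform. -/
theorem ext_of_laplaceTransform [DecidableEq X] {m : X → ℝ} (hm : ∀ x, 0 < m x) {M N : Measure (X → ℝ≥0)}
    [IsFiniteMeasure M] [IsFiniteMeasure N]
    (h : ∀ s : X → ℝ, 0 ≤ s → laplaceTransform m M s = laplaceTransform m N s) : M = N := by
  let S := laplaceSubmonoid m
  -- Exponentials are closed under products, so the algebra they generate is just their linear span;
  -- equality of integrals on it follows from equality of transforms.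
  let A : StarSubalgebra ℝ ((X → ℝ≥0) →ᵇ ℝ) :=
    { Algebra.adjoin ℝ (S : Set ((X → ℝ≥0) →ᵇ ℝ)) with
      star_mem' := fun {a} ha => by
        have : star a = a := by ext; simp
        rwa [this] }
  refine ext_of_forall_mem_subalgebra_integral_eq_of_polish (A := A) ?_ ?_
  · intro ρ σ hne
    obtain ⟨x, hx⟩ := Function.ne_iff.mp hne
    -- Testing one coordinate suffices to separate points, since `m x ≠ 0`.
    let s : X → ℝ := Pi.single x 1
    have hs : 0 ≤ s := Pi.single_nonneg.mpr zero_le_one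
    let f : (X → ℝ≥0) →ᵇ ℝ := BoundedContinuousFunction.ofNormedAddCommGroup
      (laplaceKernel m s) (by fun_prop) 1 (fun ρ => by
        rw [Real.norm_of_nonneg (laplaceKernel_pos m s ρ).le]
        exact laplaceKernel_le_one hm hs ρ)
    have hf : f ∈ A := Algebra.subset_adjoin ⟨s, hs, fun ρ => rfl⟩
    refine ⟨f, ⟨f.toContinuousMap, ⟨f, hf, rfl⟩, rfl⟩, ?_⟩
    change laplaceKernel m s ρ ≠ laplaceKernel m s σ
    unfold laplaceKernel
    intro he
    have := neg_injective (Real.exp_injective he)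
    simp only [s, Pi.single_apply, ite_mul, one_mul, zero_mul, Finset.sum_ite_eq',
      Finset.mem_univ, if_true] at this
    exact hx (NNReal.coe_injective (mul_right_cancel₀ (hm x).ne' this))
  · intro g hg
    have hg' : g ∈ Submodule.span ℝ (S : Set ((X → ℝ≥0) →ᵇ ℝ)) := by
      have : g ∈ Subalgebra.toSubmodule (Algebra.adjoin ℝ (S : Set ((X → ℝ≥0) →ᵇ ℝ))) := hg
      rwa [Algebra.adjoin_eq_span, Submonoid.closure_eq] at this
    induction hg' using Submodule.span_induction with
    | mem f hf =>
      obtain ⟨s, hs, hf⟩ := hf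
      simp only [hf]
      rw [integral_laplaceKernel, integral_laplaceKernel, h s hs]
    | zero => simp
    | add f g hf' hg' ihf ihg =>
      have mem : ∀ k ∈ Submodule.span ℝ (S : Set ((X → ℝ≥0) →ᵇ ℝ)), k ∈ A := fun k hk => by
        rw [← Submonoid.closure_eq S, ← Algebra.adjoin_eq_span] at hk
        exact hk
      simp only [BoundedContinuousFunction.coe_add, Pi.add_apply]
      rw [integral_add (f.integrable M) (g.integrable M),
        integral_add (f.integrable N) (g.integrable N), ihf (mem f hf'), ihg (mem g hg')]
    | smul c f hf' ihf =>
      have mem : ∀ k ∈ Submodule.span ℝ (S : Set ((X → ℝ≥0) →ᵇ ℝ)), k ∈ A := fun k hk => by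
        rw [← Submonoid.closure_eq S, ← Algebra.adjoin_eq_span] at hk
        exact hk
      simp only [BoundedContinuousFunction.coe_smul, integral_smul, ihf (mem f hf')]

/-- `φ` is, on the nonnegative orthant, the Laplace transform of a measure. -/
def IsLaplace (m : X → ℝ) (φ : (X → ℝ) → ℝ) : Prop :=
  (∀ s, 0 ≤ s → 0 ≤ φ s) ∧ ∃ M : Measure (X → ℝ≥0), SFinite M ∧
    ∀ s, 0 ≤ s → laplaceTransform m M s = ENNReal.ofReal (φ s)

namespace IsLaplace

variable {m : X → ℝ} {φ ψ : (X → ℝ) → ℝ}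

lemma congr (hφ : IsLaplace m φ) (h : ∀ s, 0 ≤ s → φ s = ψ s) : IsLaplace m ψ := by
  obtain ⟨h0, M, hM, hφ⟩ := hφ
  exact ⟨fun s hs => h s hs ▸ h0 s hs, M, hM, fun s hs => h s hs ▸ hφ s hs⟩

lemma const {c : ℝ} (hc : 0 ≤ c) : IsLaplace m (fun _ => c) := by
  refine ⟨fun _ _ => hc, ENNReal.ofReal c • Measure.dirac 0, inferInstance, fun s _ => ?_⟩
  simp [laplaceTransform, lintegral_dirac' _ (by fun_prop : Measurable fun ρ : X → ℝ≥0 =>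
    ENNReal.ofReal (laplaceKernel m s ρ))]

/-- The kernel is multiplicative in `ρ`, so the convolution of the representing measures works. -/
lemma mul (hφ : IsLaplace m φ) (hψ : IsLaplace m ψ) : IsLaplace m (fun s => φ s * ψ s) := by
  obtain ⟨h0, M, hM, hφ⟩ := hφ
  obtain ⟨h1, N, hN, hψ⟩ := hψ
  refine ⟨fun s hs => mul_nonneg (h0 s hs) (h1 s hs), M.conv N, ?_, fun s hs => ?_⟩
  · unfold Measure.conv; infer_instance
  · unfold laplaceTransform
    rw [Measure.lintegral_conv (by fun_prop)]
    simp only [laplaceKernel_add_right, ENNReal.ofReal_mul (laplaceKernel_pos _ _ _).le]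
    simp only [lintegral_const_mul _ (by fun_prop : Measurable fun ρ : X → ℝ≥0 =>
      ENNReal.ofReal (laplaceKernel m s ρ))]
    rw [lintegral_mul_const _ (by fun_prop), ENNReal.ofReal_mul (h0 s hs), ← hφ s hs, ← hψ s hs]
    rfl

lemma pow (hφ : IsLaplace m φ) (n : ℕ) : IsLaplace m (fun s => φ s ^ n) := by
  induction n with
  | zero => simpa using const zero_le_one
  | succ n ih => simpa only [pow_succ] using ih.mul hφ

lemma prod {ι : Type*} (t : Finset ι) {φ : ι → (X → ℝ) → ℝ} (h : ∀ i, IsLaplace m (φ i)) :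
    IsLaplace m (fun s => ∏ i ∈ t, φ i s) := by
  classical
  induction t using Finset.induction_on with
  | empty => simpa using const zero_le_one
  | insert i t hi ih => simpa only [Finset.prod_insert hi] using (h i).mul ih

lemma tsum {ι : Type*} [Countable ι] {φ : ι → (X → ℝ) → ℝ} (h : ∀ i, IsLaplace m (φ i))
    (hs : ∀ s, 0 ≤ s → Summable fun i => φ i s) : IsLaplace m (fun s => ∑' i, φ i s) := by
  choose h0 M hM hφ using h
  refine ⟨fun s hs => tsum_nonneg fun i => h0 i s hs, Measure.sum M, inferInstance,
    fun s hs' => ?_⟩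
  unfold laplaceTransform at hφ ⊢
  rw [lintegral_sum_measure, ENNReal.ofReal_tsum_of_nonneg (fun i => h0 i s hs') (hs s hs')]
  exact tsum_congr fun i => hφ i s hs'

lemma sum {ι : Type*} [Fintype ι] {φ : ι → (X → ℝ) → ℝ} (h : ∀ i, IsLaplace m (φ i)) :
    IsLaplace m (fun s => ∑ i, φ i s) :=
  (tsum h fun _ _ => (hasSum_fintype _).summable).congr fun _ _ => tsum_fintype _

lemma exp (hφ : IsLaplace m φ) : IsLaplace m (fun s => Real.exp (φ s)) := by
  refine (tsum (φ := fun (n : ℕ) s => (n.factorial : ℝ)⁻¹ * φ s ^ n)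
    (fun n => (const (by positivity)).mul (hφ.pow n)) fun s _ => ?_).congr fun s _ => ?_
  · simpa [div_eq_inv_mul] using Real.summable_pow_div_factorial (φ s)
  · rw [Real.exp_eq_exp_ℝ, NormedSpace.exp_eq_tsum_div]
    simp only [div_eq_inv_mul]

-- Exponential tilting turns the gamma density of rate `r` into a constant times the one of rate `r
-- + b`.
open ProbabilityTheory in
lemma _root_.Dynkin.lintegral_exp_gammaMeasure {a r b : ℝ} (ha : 0 < a) (hr : 0 < r)
    (hb : 0 ≤ b) : ∫⁻ y, ENNReal.ofReal (Real.exp (-(b * y))) ∂gammaMeasure a r =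
      ENNReal.ofReal ((r / (r + b)) ^ a) := by
  have hrb : 0 < r + b := by positivity
  have hpdf : ∀ y, gammaPDFReal a r y * Real.exp (-(b * y)) =
      (r / (r + b)) ^ a * gammaPDFReal a (r + b) y := fun y => by
    unfold gammaPDFReal
    split_ifs with hy
    · rw [Real.div_rpow hr.le hrb.le, mul_assoc, ← Real.exp_add]
      have : (r + b) ^ a ≠ 0 := (Real.rpow_pos_of_pos hrb _).ne'
      have : Real.Gamma a ≠ 0 := (Real.Gamma_pos_of_pos ha).ne'
      have h : -(r * y) + -(b * y) = -((r + b) * y) := by ring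
      rw [h]
      field_simp
    · simp
  have hmeas : Measurable (gammaPDF a r) := (measurable_gammaPDFReal a r).ennreal_ofReal
  rw [gammaMeasure, lintegral_withDensity_eq_lintegral_mul _ hmeas (by fun_prop)]
  simp only [Pi.mul_apply, gammaPDF, ← ENNReal.ofReal_mul (gammaPDFReal_nonneg ha hr _), hpdf]
  simp only [ENNReal.ofReal_mul (Real.rpow_nonneg (div_nonneg hr.le hrb.le) a)]
  rw [lintegral_const_mul _ (measurable_gammaPDFReal a (r + b)).ennreal_ofReal]
  have := lintegral_gammaPDF_eq_one ha hrb
  unfold gammaPDF at this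
  rw [this, mul_one]

/-- Powers of `s ↦ q / (q + s x)` are Laplace transforms of gamma laws. -/
lemma gamma [DecidableEq X] (hm : ∀ x, 0 < m x) (x : X) {q a : ℝ} (hq : 0 < q) (ha : 0 < a) :
    IsLaplace m (fun s => (q / (q + s x)) ^ a) := by
  have : IsProbabilityMeasure (ProbabilityTheory.gammaMeasure a (q * m x)) :=
    ProbabilityTheory.isProbabilityMeasure_gammaMeasure ha (mul_pos hq (hm x))
  have hmeas : Measurable fun y : ℝ => (Pi.single x y.toNNReal : X → ℝ≥0) := by
    refine measurable_pi_lambda _ fun z => ?_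
    by_cases h : z = x
    · subst h; simpa using measurable_real_toNNReal
    · simp [h]
  -- The gamma law sits on the axis of `x`. Its rate is `q * m x` because the kernel weights that
  -- coordinate by `m x`, which then cancels.
  refine ⟨fun s hs => Real.rpow_nonneg (div_nonneg hq.le (add_nonneg hq.le (hs x))) a,
    (ProbabilityTheory.gammaMeasure a (q * m x)).map fun y => Pi.single x y.toNNReal,
    inferInstance, fun s hs => ?_⟩
  unfold laplaceTransform
  rw [lintegral_map (by fun_prop) hmeas]
  have hae : ∀ᵐ y ∂ProbabilityTheory.gammaMeasure a (q * m x), 0 ≤ y := by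
    rw [ae_iff]
    simp only [not_le]
    rw [ProbabilityTheory.gammaMeasure]
    change (volume.withDensity _) (Set.Iio 0) = 0
    rw [withDensity_apply _ measurableSet_Iio]
    exact ProbabilityTheory.lintegral_gammaPDF_of_nonpos le_rfl
  rw [lintegral_congr_ae (g := fun y => ENNReal.ofReal (Real.exp (-(s x * m x * y)))),
    lintegral_exp_gammaMeasure ha (mul_pos hq (hm x)) (mul_nonneg (hs x) (hm x).le)]
  · rw [← add_mul, mul_div_mul_right _ _ (hm x).ne']
  · filter_upwards [hae] with y hy
    congr 1
    unfold laplaceKernel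
    congr 2
    rw [Finset.sum_eq_single x (fun z _ hz => by simp [hz]) (by simp)]
    simp [Real.coe_toNNReal _ hy]
    ring

end IsLaplace

end Laplace

end Dynkin

end

noncomputable section

namespace Dynkin

/-! ### Chernoff's product formula. -/

section Chernoff

variable {𝔸 : Type*} [NormedRing 𝔸] [NormOneClass 𝔸]

/-- Telescoping, one factor exchanged at a time. -/
lemma norm_pow_sub_pow_le {a b : 𝔸} {K : ℝ} (hK : 1 ≤ K) (ha : ‖a‖ ≤ K) (hb : ‖b‖ ≤ K) (n : ℕ) :
    ‖a ^ n - b ^ n‖ ≤ n * K ^ n * ‖a - b‖ := by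
  have hK0 : 0 ≤ K := zero_le_one.trans hK
  induction n with
  | zero => simp
  | succ n ih =>
    have h : a ^ (n + 1) - b ^ (n + 1) = a * (a ^ n - b ^ n) + (a - b) * b ^ n := by
      rw [pow_succ', pow_succ']; noncomm_ring
    have hbn : ‖b ^ n‖ ≤ K ^ n := (norm_pow_le b n).trans (pow_le_pow_left₀ (norm_nonneg _) hb n)
    calc ‖a ^ (n + 1) - b ^ (n + 1)‖
        ≤ ‖a‖ * ‖a ^ n - b ^ n‖ + ‖a - b‖ * ‖b ^ n‖ := by
          rw [h]
          exact (norm_add_le _ _).trans (add_le_add (norm_mul_le _ _) (norm_mul_le _ _))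
      _ ≤ K * (n * K ^ n * ‖a - b‖) + ‖a - b‖ * K ^ (n + 1) := by
          gcongr
          exact hbn.trans (pow_le_pow_right₀ hK n.le_succ)
      _ = ((n + 1 : ℕ) : ℝ) * K ^ (n + 1) * ‖a - b‖ := by push_cast; ring

variable [NormedAlgebra ℝ 𝔸]

/-- An exponential bound is what keeps `f (t / n) ^ n` bounded uniformly in `n`. -/
lemma exists_norm_le_exp_of_hasDerivAt {f : ℝ → 𝔸} {C : 𝔸} (h0 : f 0 = 1)
    (hf : HasDerivAt f C 0) : ∃ K, ∀ᶠ h in 𝓝 (0 : ℝ), ‖f h‖ ≤ Real.exp (K * ‖h‖) := by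
  obtain ⟨K, hK⟩ := hf.isBigO_sub.bound
  refine ⟨K, ?_⟩
  filter_upwards [hK] with h hh
  rw [h0, sub_zero] at hh
  calc ‖f h‖ ≤ ‖f h - 1‖ + ‖(1 : 𝔸)‖ := by simpa using norm_add_le (f h - 1) 1
    _ ≤ K * ‖h‖ + 1 := by rw [norm_one]; gcongr
    _ ≤ Real.exp (K * ‖h‖) := Real.add_one_le_exp _

/-- Chernoff's product formula in a Banach algebra. -/
theorem tendsto_pow_exp_of_hasDerivAt [CompleteSpace 𝔸] {f : ℝ → 𝔸} {C : 𝔸} (h0 : f 0 = 1)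
    (hf : HasDerivAt f C 0) (t : ℝ) :
    Tendsto (fun n : ℕ => f (t / n) ^ n) atTop (𝓝 (NormedSpace.exp (t • C))) := by
  have hg : HasDerivAt (fun h : ℝ => NormedSpace.exp (h • C)) C 0 := by
    simpa using hasDerivAt_exp_smul_const (𝕂 := ℝ) C 0
  have hg0 : (fun h : ℝ => NormedSpace.exp (h • C)) 0 = 1 := by simp
  obtain ⟨K₁, hK₁⟩ := exists_norm_le_exp_of_hasDerivAt h0 hf
  obtain ⟨K₂, hK₂⟩ := exists_norm_le_exp_of_hasDerivAt hg0 hg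
  have hd : (fun h : ℝ => f h - NormedSpace.exp (h • C)) =o[𝓝 0] fun h => h := by
    have := (hasDerivAt_iff_isLittleO_nhds_zero.mp (hf.sub hg))
    simpa [h0] using this
  have ht : Tendsto (fun n : ℕ => t / n) atTop (𝓝 0) := tendsto_const_div_atTop_nhds_zero_nat t
  -- The maximum with `0` ensures that the common bound `exp (K * ‖t / n‖)` is at least `1`, as the
  -- telescoping estimate requires.
  set K := max (max K₁ K₂) 0 with hK
  have hexp : ∀ n : ℕ, n ≠ 0 → NormedSpace.exp ((t / n) • C) ^ n = NormedSpace.exp (t • C) :=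
    fun n hn => by
      let +nondep : NormedAlgebra ℚ 𝔸 := .restrictScalars ℚ ℝ 𝔸
      rw [← NormedSpace.exp_nsmul, ← Nat.cast_smul_eq_nsmul ℝ, smul_smul,
        mul_div_cancel₀ _ (Nat.cast_ne_zero.mpr hn)]
  rw [tendsto_iff_norm_sub_tendsto_zero]
  -- The two curves agree to first order at `0`, so `n` times their difference at `t / n` is `n ·
  -- o(t / n)`.
  have hlim : Tendsto (fun n : ℕ => Real.exp (K * ‖t‖) *
      (n * ‖f (t / n) - NormedSpace.exp ((t / n) • C)‖)) atTop (𝓝 0) := by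
    have h1 : (fun n : ℕ => f (t / n) - NormedSpace.exp ((t / n) • C)) =o[atTop]
        fun n : ℕ => t / n := hd.comp_tendsto ht
    have h2 : (fun n : ℕ => (n : ℝ) * ‖f (t / n) - NormedSpace.exp ((t / n) • C)‖) =o[atTop]
        fun n : ℕ => (n : ℝ) * (t / n) := (Asymptotics.isBigO_refl _ _).mul_isLittleO h1.norm_left
    have h3 : (fun n : ℕ => (n : ℝ) * (t / n)) =O[atTop] fun _ : ℕ => (1 : ℝ) := by
      refine Asymptotics.IsBigO.of_bound ‖t‖ ?_
      filter_upwards [eventually_ne_atTop 0] with n hn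
      rw [mul_div_cancel₀ _ (Nat.cast_ne_zero.mpr hn)]
      simp
    simpa using ((Asymptotics.isLittleO_one_iff ℝ).mp (h2.trans_isBigO h3)).const_mul
      (Real.exp (K * ‖t‖))
  refine squeeze_zero' (Eventually.of_forall fun _ => norm_nonneg _) ?_ hlim
  filter_upwards [ht.eventually hK₁, ht.eventually hK₂, eventually_ne_atTop 0] with n h1 h2 hn
  have hn' : (0 : ℝ) < n := by positivity
  have b1 : Real.exp (K₁ * ‖t / n‖) ≤ Real.exp (K * ‖t / n‖) := by
    gcongr; exact (le_max_left _ _).trans (le_max_left _ _)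
  have b2 : Real.exp (K₂ * ‖t / n‖) ≤ Real.exp (K * ‖t / n‖) := by
    gcongr; exact (le_max_right _ _).trans (le_max_left _ _)
  have b3 : 1 ≤ Real.exp (K * ‖t / n‖) :=
    Real.one_le_exp (mul_nonneg (le_max_right _ _) (norm_nonneg _))
  have := norm_pow_sub_pow_le b3 (h1.trans b1) (h2.trans b2) n
  rw [hexp n hn, ← Real.exp_nat_mul] at this
  refine this.trans (le_of_eq ?_)
  rw [norm_div, Real.norm_natCast]
  have : (n : ℝ) * (K * (‖t‖ / n)) = K * ‖t‖ := by field_simp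
  rw [this]; ring

end Chernoff

/-! ### Nonnegative matrices, semigroups and their potentials. -/

section Generator

open scoped Matrix.Norms.Operator

lemma one_apply_nonneg {X : Type*} [DecidableEq X] (x y : X) : 0 ≤ (1 : Matrix X X ℝ) x y := by
  rw [Matrix.one_apply]; split_ifs <;> norm_num

variable {X : Type*} [Fintype X]

lemma mul_apply_mono {A B C D : Matrix X X ℝ} (hA : ∀ x y, 0 ≤ A x y) (hAB : ∀ x y, A x y ≤ B x y)
    (hC : ∀ x y, 0 ≤ C x y) (hCD : ∀ x y, C x y ≤ D x y) (x y : X) :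
    (A * C) x y ≤ (B * D) x y := by
  simp only [Matrix.mul_apply]
  exact Finset.sum_le_sum fun z _ =>
    mul_le_mul (hAB x z) (hCD z y) (hC z y) ((hA x z).trans (hAB x z))

lemma mul_apply_nonneg {A B : Matrix X X ℝ} (hA : ∀ x y, 0 ≤ A x y) (hB : ∀ x y, 0 ≤ B x y)
    (x y : X) : 0 ≤ (A * B) x y := by
  simp only [Matrix.mul_apply]
  exact Finset.sum_nonneg fun z _ => mul_nonneg (hA x z) (hB z y)

variable [DecidableEq X]

lemma hasSum_exp_apply (A : Matrix X X ℝ) (x y : X) :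
    HasSum (fun n : ℕ => (n.factorial : ℝ)⁻¹ * (A ^ n) x y) (NormedSpace.exp A x y) := by
  have h := NormedSpace.exp_series_hasSum_exp' (𝕂 := ℝ) A
  exact Pi.hasSum.mp (Pi.hasSum.mp h x) y

lemma pow_apply_nonneg {A : Matrix X X ℝ} (hA : ∀ x y, 0 ≤ A x y) (n : ℕ) (x y : X) :
    0 ≤ (A ^ n) x y := by
  induction n generalizing x y with
  | zero => simpa using one_apply_nonneg x y
  | succ n ih => rw [pow_succ]; exact mul_apply_nonneg ih hA x y

lemma pow_apply_mono {A B : Matrix X X ℝ} (hA : ∀ x y, 0 ≤ A x y) (hAB : ∀ x y, A x y ≤ B x y)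
    (n : ℕ) (x y : X) : (A ^ n) x y ≤ (B ^ n) x y := by
  induction n generalizing x y with
  | zero => simp
  | succ n ih =>
    rw [pow_succ, pow_succ]
    exact mul_apply_mono (pow_apply_nonneg hA n) ih hA hAB x y

lemma exp_apply_nonneg {A : Matrix X X ℝ} (hA : ∀ x y, 0 ≤ A x y) (x y : X) :
    0 ≤ NormedSpace.exp A x y :=
  (hasSum_exp_apply A x y).nonneg fun n => mul_nonneg (by positivity) (pow_apply_nonneg hA n x y)

lemma exp_apply_mono {A B : Matrix X X ℝ} (hA : ∀ x y, 0 ≤ A x y) (hAB : ∀ x y, A x y ≤ B x y)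
    (x y : X) : NormedSpace.exp A x y ≤ NormedSpace.exp B x y :=
  hasSum_le (fun n => mul_le_mul_of_nonneg_left (pow_apply_mono hA hAB n x y) (by positivity))
    (hasSum_exp_apply A x y) (hasSum_exp_apply B x y)

lemma exp_sub_smul_one (A : Matrix X X ℝ) (c : ℝ) :
    NormedSpace.exp (A - c • (1 : Matrix X X ℝ)) = Real.exp (-c) • NormedSpace.exp A := by
  rw [sub_eq_add_neg, ← neg_smul, Matrix.exp_add_of_commute _ _ ((Commute.one_right A).smul_right _)]
  have : NormedSpace.exp ((-c) • (1 : Matrix X X ℝ)) = Real.exp (-c) • (1 : Matrix X X ℝ) := by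
    rw [← Algebra.algebraMap_eq_smul_one, ← Algebra.algebraMap_eq_smul_one, Real.exp_eq_exp_ℝ]
    exact (NormedSpace.algebraMap_exp_comm (𝕂 := ℝ) (𝔸 := Matrix X X ℝ) (-c)).symm
  rw [this, Matrix.mul_smul, Matrix.mul_one]

/-- Adding `c • 1` makes all entries of `A` nonnegative and only multiplies the exponential by a
positive scalar; the exponential series is then monotone term by term. -/
lemma semigroup_apply_mono {A B : Matrix X X ℝ} (hA : ∀ x y, x ≠ y → 0 ≤ A x y)
    (hAB : ∀ x y, A x y ≤ B x y) {t : ℝ} (ht : 0 ≤ t) (x y : X) :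
    0 ≤ semigroup A t x y ∧ semigroup A t x y ≤ semigroup B t x y := by
  obtain ⟨c, hc⟩ : ∃ c : ℝ, ∀ z, 0 ≤ A z z + c := by
    refine ⟨∑ z, |A z z|, fun z => ?_⟩
    have h1 : |A z z| ≤ ∑ z, |A z z| := Finset.single_le_sum (f := fun z => |A z z|)
      (fun z _ => abs_nonneg _) (Finset.mem_univ z)
    have h2 := neg_abs_le (A z z)
    linarith
  have key : ∀ C : Matrix X X ℝ, semigroup C t =
      Real.exp (-(t * c)) • NormedSpace.exp (t • (C + c • (1 : Matrix X X ℝ))) := fun C => by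
    rw [← exp_sub_smul_one, semigroup]
    congr 1
    rw [smul_add, smul_smul, add_sub_cancel_right]
  have h0 : ∀ z w, 0 ≤ (t • (A + c • (1 : Matrix X X ℝ))) z w := fun z w => by
    by_cases h : z = w
    · subst h; simpa using mul_nonneg ht (hc z)
    · simpa [Matrix.one_apply, h] using mul_nonneg ht (hA z w h)
  have h1 : ∀ z w, (t • (A + c • (1 : Matrix X X ℝ))) z w ≤
      (t • (B + c • (1 : Matrix X X ℝ))) z w := fun z w => by
    simp only [Matrix.smul_apply, Matrix.add_apply, smul_eq_mul]
    have := hAB z w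
    gcongr
  rw [key A, key B]
  simp only [Matrix.smul_apply, smul_eq_mul]
  exact ⟨mul_nonneg (Real.exp_pos _).le (exp_apply_nonneg h0 x y),
    mul_le_mul_of_nonneg_left (exp_apply_mono h0 h1 x y) (Real.exp_pos _).le⟩

lemma hasDerivAt_semigroup (A : Matrix X X ℝ) (t : ℝ) :
    HasDerivAt (semigroup A) (A * semigroup A t) t :=
  hasDerivAt_exp_smul_const' (𝕂 := ℝ) A t

lemma hasDerivAt_semigroup_apply (A : Matrix X X ℝ) (t : ℝ) (x y : X) :
    HasDerivAt (fun t => semigroup A t x y) ((A * semigroup A t) x y) t :=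
  hasDerivAt_pi.mp (hasDerivAt_pi.mp (hasDerivAt_semigroup A t) x) y

@[simp]
lemma semigroup_zero (A : Matrix X X ℝ) : semigroup A 0 = 1 := by simp [semigroup]

/-- A left null vector of `A` would be invariant under the semigroup, which is impossible if the
latter tends to `0`. -/
lemma det_ne_zero_of_tendsto_semigroup {A : Matrix X X ℝ}
    (hA : Tendsto (semigroup A) atTop (𝓝 0)) : A.det ≠ 0 := by
  intro h
  obtain ⟨v, hv, hAv⟩ := Matrix.exists_vecMul_eq_zero_iff.mpr h
  refine hv ?_
  have hd : ∀ t, HasDerivAt (fun t => Matrix.vecMul v (semigroup A t)) 0 t := fun t => by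
    refine hasDerivAt_pi.mpr fun y => ?_
    have := HasDerivAt.fun_sum (u := Finset.univ) fun x _ =>
      (hasDerivAt_semigroup_apply A t x y).const_mul (v x)
    convert! this using 1
    change (0 : X → ℝ) y = Matrix.vecMul v (A * semigroup A t) y
    rw [← Matrix.vecMul_vecMul, hAv, Matrix.zero_vecMul]
  have hconst : ∀ t, Matrix.vecMul v (semigroup A t) = v := fun t => by
    have := is_const_of_deriv_eq_zero (f := fun t => Matrix.vecMul v (semigroup A t))
      (fun t => (hd t).differentiableAt) (fun t => (hd t).deriv) t 0
    simpa using this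
  have hlim : Tendsto (fun t => Matrix.vecMul v (semigroup A t)) atTop (𝓝 (Matrix.vecMul v 0)) :=
    ((continuous_const.matrix_vecMul continuous_id).tendsto 0).comp hA
  simp only [hconst, Matrix.vecMul_zero] at hlim
  exact tendsto_nhds_unique tendsto_const_nhds hlim

/-- `A⁻¹ e^{tA}` is a primitive vanishing at infinity. Since the integrand is nonnegative,
integrability needs no rate of decay. -/
lemma integral_semigroup {A : Matrix X X ℝ} (hA : Tendsto (semigroup A) atTop (𝓝 0))
    (h0 : ∀ t, 0 ≤ t → ∀ x y, 0 ≤ semigroup A t x y) (x y : X) :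
    IntegrableOn (fun t => semigroup A t x y) (Set.Ioi 0) ∧
      ∫ t in Set.Ioi 0, semigroup A t x y = (-A)⁻¹ x y := by
  have hdet : IsUnit A.det := isUnit_iff_ne_zero.mpr (det_ne_zero_of_tendsto_semigroup hA)
  let g : ℝ → ℝ := fun t => (A⁻¹ * semigroup A t) x y
  have hd : ∀ t ∈ Set.Ici (0 : ℝ), HasDerivAt g (semigroup A t x y) t := fun t _ => by
    have := HasDerivAt.fun_sum (u := Finset.univ) fun z _ =>
      (hasDerivAt_semigroup_apply A t z y).const_mul (A⁻¹ x z)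
    convert! this using 1
    change _ = (A⁻¹ * (A * semigroup A t)) x y
    rw [← Matrix.mul_assoc, Matrix.nonsing_inv_mul _ hdet, Matrix.one_mul]
  have hlim : Tendsto g atTop (𝓝 0) := by
    have h1 : Continuous fun M : Matrix X X ℝ => (A⁻¹ * M) x y :=
      (continuous_const.matrix_mul continuous_id).matrix_elem x y
    have h2 := (h1.tendsto 0).comp hA
    rwa [Matrix.mul_zero] at h2
  refine ⟨integrableOn_Ioi_deriv_of_nonneg' hd (fun t ht => h0 t (le_of_lt ht) x y) hlim, ?_⟩
  rw [integral_Ioi_of_hasDerivAt_of_nonneg' hd (fun t ht => h0 t (le_of_lt ht) x y) hlim,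
    zero_sub]
  simp only [g, semigroup_zero, Matrix.mul_one]
  have : (-A)⁻¹ = -A⁻¹ := by
    refine Matrix.inv_eq_left_inv ?_
    rw [neg_mul_neg, Matrix.nonsing_inv_mul _ hdet]
  rw [this, Matrix.neg_apply]

end Generator

end Dynkin

end

noncomputable section

namespace Dynkin

/-! ### The logarithm of a determinant as a trace series. -/

section LogDet

variable {X : Type*} [Fintype X] [DecidableEq X]

/-- The partial sums are `N - N * A ^ K`, hence bounded by `N`. A nonnegative inverse thus replaces
any bound on the spectral radius. -/
lemma summable_pow_apply {A N : Matrix X X ℝ} (hA : ∀ x y, 0 ≤ A x y) (hN : ∀ x y, 0 ≤ N x y)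
    (h : N * (1 - A) = 1) (x y : X) : Summable fun k : ℕ => (A ^ k) x y := by
  refine summable_of_sum_range_le (c := N x y) (fun k => pow_apply_nonneg hA k x y) fun K => ?_
  have key : ∑ k ∈ Finset.range K, A ^ k = N - N * A ^ K := by
    induction K with
    | zero => simp
    | succ K ih =>
      have : N * A ^ (K + 1) = N * A ^ K - A ^ K := by
        have h' : N * A = N - 1 := by rw [← h]; noncomm_ring
        rw [pow_succ', ← mul_assoc, h', sub_mul, one_mul]
      rw [Finset.sum_range_succ, ih, this]
      abel
  have := congrFun (congrFun key x) y
  rw [Matrix.sum_apply, Matrix.sub_apply] at this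
  rw [this]
  linarith [mul_apply_nonneg hN (pow_apply_nonneg hA K) x y]

lemma hasDerivAt_det_one_add_smul (M : Matrix X X ℝ) :
    HasDerivAt (fun h : ℝ => (1 + h • M).det) M.trace 0 := by
  obtain ⟨p, hp⟩ : ∃ p : Polynomial ℝ, ∀ h : ℝ, (1 + h • M).det =
      1 + M.trace * h + p.eval h * h ^ 2 := ⟨_, fun h => Matrix.det_one_add_smul h M⟩
  rw [funext hp]
  have h1 := ((hasDerivAt_id (0 : ℝ)).const_mul M.trace).const_add 1
  have h2 := (p.hasDerivAt 0).mul (hasDerivAt_pow 2 (0 : ℝ))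
  convert! h1.add h2 using 1
  simp

/-- Factoring out `1 - t • A` reduces the claim to the derivative of the determinant at the
identity. -/
lemma hasDerivAt_det_one_sub_smul {A R : Matrix X X ℝ} {t : ℝ} (hR : (1 - t • A) * R = 1) :
    HasDerivAt (fun t : ℝ => (1 - t • A).det) (-((1 - t • A).det * (R * A).trace)) t := by
  have h1 : ∀ u : ℝ, (1 - u • A).det = (1 - t • A).det * (1 + (t - u) • (R * A)).det := fun u => by
    rw [← Matrix.det_mul, mul_add, mul_one, mul_smul_comm, ← mul_assoc, hR, one_mul]
    congr 1
    module
  have h2 : HasDerivAt (fun u : ℝ => t - u) (-1) t := by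
    simpa using (hasDerivAt_id t).const_sub t
  have h3 := hasDerivAt_det_one_add_smul (R * A)
  rw [← sub_self t] at h3
  have h4 := (h3.comp t h2).const_mul (1 - t • A).det
  rw [funext h1]
  convert! h4 using 1
  ring

/-- `det (1 - A) = exp (-∑ tr (A ^ k) / k)` for a nonnegative matrix `A` with summable powers. -/
theorem det_one_sub_mul_exp_tsum_trace {A N : Matrix X X ℝ} (hA : ∀ x y, 0 ≤ A x y)
    (hN : ∀ x y, 0 ≤ N x y) (h : N * (1 - A) = 1) :
    (Summable fun k : ℕ => (A ^ (k + 1)).trace / (k + 1)) ∧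
      (1 - A).det * Real.exp (∑' k : ℕ, (A ^ (k + 1)).trace / (k + 1)) = 1 := by
  have hsum := summable_pow_apply hA hN h
  obtain ⟨a, ha⟩ : ∃ a : ℕ → ℝ, ∀ k, (A ^ (k + 1)).trace = a k := ⟨_, fun _ => rfl⟩
  simp only [ha]
  have ha0 : ∀ k, 0 ≤ a k := fun k => by
    rw [← ha]
    exact Finset.sum_nonneg fun x _ => pow_apply_nonneg hA _ x x
  have has : Summable a := by
    have : Summable fun k : ℕ => (A ^ k).trace := by
      simp only [Matrix.trace, Matrix.diag]
      exact summable_sum fun x _ => hsum x x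
    simpa only [ha] using (summable_nat_add_iff 1).mpr this
  have hdiv : ∀ k : ℕ, a k / (k + 1) ≤ a k := fun k =>
    div_le_self (ha0 k) (by linarith [k.cast_nonneg (α := ℝ)])
  refine ⟨Summable.of_nonneg_of_le (fun k => div_nonneg (ha0 k) (by positivity)) hdiv has, ?_⟩
  -- The exponent is interpolated by scaling `A` to `t • A`; then `det (1 - t • A) * exp (ψ t)` is
  -- constant on `[0, 1]`. Its derivative is computed for `t < 1`, and `t = 1` is reached by
  -- continuity.
  set ψ : ℝ → ℝ := fun t => ∑' k : ℕ, t ^ (k + 1) * (a k / (k + 1)) with hψ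
  have hψd : ∀ t ∈ Set.Ioo (-1 : ℝ) 1, HasDerivAt ψ (∑' k : ℕ, t ^ k * a k) t := fun t ht => by
    refine hasDerivAt_tsum_of_isPreconnected (𝕜 := ℝ) (F := ℝ)
      (g := fun k t => t ^ (k + 1) * (a k / (k + 1))) (g' := fun k t => t ^ k * a k) (u := a) has isOpen_Ioo isPreconnected_Ioo
      (y₀ := 0) (fun k y _ => ?_) (fun k y hy => ?_) ⟨by norm_num, by norm_num⟩ ?_ ht
    · have h1 := (hasDerivAt_pow (k + 1) y).mul_const (a k / (k + 1))
      convert! h1 using 1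
      push_cast
      have : (k : ℝ) + 1 ≠ 0 := by positivity
      field_simp
    · rw [norm_mul, norm_pow, Real.norm_of_nonneg (ha0 k)]
      exact mul_le_of_le_one_left (ha0 k) (pow_le_one₀ (norm_nonneg _) (abs_lt.mpr hy).le)
    · simp
  have hψc : ContinuousOn ψ (Set.Icc 0 1) := by
    refine continuousOn_tsum (u := a) (fun k => by fun_prop) has fun k t ht => ?_
    rw [norm_mul, norm_pow, Real.norm_of_nonneg ht.1,
      Real.norm_of_nonneg (div_nonneg (ha0 k) (by positivity))]
    exact (mul_le_of_le_one_left (div_nonneg (ha0 k) (by positivity))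
      (pow_le_one₀ ht.1 ht.2)).trans (hdiv k)
  have hdetc : Continuous fun t : ℝ => (1 - t • A).det :=
    (continuous_const.sub (continuous_id.smul continuous_const)).matrix_det
  have hderiv : ∀ t ∈ Set.Ico (0 : ℝ) 1,
      HasDerivWithinAt (fun t => (1 - t • A).det * Real.exp (ψ t)) 0 (Set.Ici t) t := by
    intro t ht
    have ht' : t ∈ Set.Ioo (-1 : ℝ) 1 := ⟨by linarith [ht.1], ht.2⟩
    have hst : Summable fun k : ℕ => (t • A) ^ k := by
      refine Pi.summable.mpr fun x => Pi.summable.mpr fun y => ?_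
      refine Summable.of_nonneg_of_le (fun k => ?_) (fun k => ?_) (hsum x y)
      · rw [smul_pow]
        exact mul_nonneg (pow_nonneg ht.1 k) (pow_apply_nonneg hA k x y)
      · rw [smul_pow]
        exact mul_le_of_le_one_left (pow_apply_nonneg hA k x y) (pow_le_one₀ ht.1 ht.2.le)
    set R := ∑' k : ℕ, (t • A) ^ k with hRdef
    have hR : (1 - t • A) * R = 1 := hst.one_sub_mul_tsum_pow
    have htr : (R * A).trace = ∑' k : ℕ, t ^ k * a k := by
      rw [hRdef, ← hst.tsum_mul_right]
      have hst' : Summable fun k : ℕ => (t • A) ^ k * A := hst.mul_right A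
      have := (hst'.hasSum.map (Matrix.traceAddMonoidHom X ℝ)
        (continuous_id.matrix_trace)).tsum_eq
      change _ = Matrix.trace _ at this
      rw [← this]
      refine tsum_congr fun k => ?_
      rw [Function.comp_apply, Matrix.traceAddMonoidHom_apply, ← ha, smul_pow, smul_mul_assoc,
        Matrix.trace_smul, pow_succ, smul_eq_mul]
    have hd := (hasDerivAt_det_one_sub_smul hR).mul (hψd t ht').exp
    rw [htr] at hd
    convert! hd.hasDerivWithinAt using 1
    ring
  have := constant_of_has_deriv_right_zero (hdetc.continuousOn.mul hψc.rexp) hderiv 1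
    ⟨zero_le_one, le_rfl⟩
  simpa [hψ] using this

end LogDet

/-! ### The resolvent, the roots of `Φ` and the positivity of `m`. -/

section Resolvent

variable {X : Type*} [Fintype X] [DecidableEq X]

/-- The resolvent `(-L + M_s)⁻¹`. -/
def resolvent (L : Matrix X X ℝ) (s : X → ℝ) : Matrix X X ℝ := (-L + Matrix.diagonal s)⁻¹

variable {L : Matrix X X ℝ} {s : X → ℝ}

lemma semigroup_sub_diagonal_le (hL : IsSubMarkovGenerator L) (hs : 0 ≤ s) {t : ℝ} (ht : 0 ≤ t)
    (x y : X) : 0 ≤ semigroup (L - Matrix.diagonal s) t x y ∧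
      semigroup (L - Matrix.diagonal s) t x y ≤ semigroup L t x y := by
  refine semigroup_apply_mono (fun z w hzw => ?_) (fun z w => ?_) ht x y
  · simpa [Matrix.diagonal_apply_ne _ hzw] using hL.offDiag_nonneg z w hzw
  · by_cases h : z = w
    · subst h; simpa using hs z
    · simp [h]

lemma semigroup_nonneg (hL : IsSubMarkovGenerator L) {t : ℝ} (ht : 0 ≤ t) (x y : X) :
    0 ≤ semigroup L t x y :=
  (semigroup_apply_mono hL.offDiag_nonneg (fun _ _ => le_rfl) ht x y).1

lemma tendsto_semigroup_sub_diagonal (hL : IsSubMarkovGenerator L) (hζ : HasFiniteLifetime L)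
    (hs : 0 ≤ s) : Tendsto (semigroup (L - Matrix.diagonal s)) atTop (𝓝 0) := by
  refine tendsto_pi_nhds.mpr fun x => tendsto_pi_nhds.mpr fun y => ?_
  refine squeeze_zero' ?_ ?_ (hζ x)
  · filter_upwards [eventually_ge_atTop 0] with t ht
    exact (semigroup_sub_diagonal_le hL hs ht x y).1
  · filter_upwards [eventually_ge_atTop 0] with t ht
    exact (semigroup_sub_diagonal_le hL hs ht x y).2.trans
      (Finset.single_le_sum (f := fun y => semigroup L t x y)
        (fun y _ => semigroup_nonneg hL ht x y) (Finset.mem_univ y))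

lemma neg_sub_diagonal {X : Type*} [DecidableEq X] (L : Matrix X X ℝ) (s : X → ℝ) :
    -(L - Matrix.diagonal s) = -L + Matrix.diagonal s := by abel

lemma isUnit_det_neg_add_diagonal (hL : IsSubMarkovGenerator L) (hζ : HasFiniteLifetime L)
    (hs : 0 ≤ s) : IsUnit (-L + Matrix.diagonal s).det := by
  rw [← neg_sub_diagonal, Matrix.det_neg, isUnit_iff_ne_zero]
  exact mul_ne_zero (pow_ne_zero _ (by norm_num))
    (det_ne_zero_of_tendsto_semigroup (tendsto_semigroup_sub_diagonal hL hζ hs))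

/-- The resolvent is the Laplace transform of the killed semigroup. -/
lemma integral_semigroup_sub_diagonal (hL : IsSubMarkovGenerator L) (hζ : HasFiniteLifetime L)
    (hs : 0 ≤ s) (x y : X) :
    IntegrableOn (fun t => semigroup (L - Matrix.diagonal s) t x y) (Set.Ioi 0) ∧
      ∫ t in Set.Ioi 0, semigroup (L - Matrix.diagonal s) t x y = resolvent L s x y := by
  rw [resolvent, ← neg_sub_diagonal]
  exact integral_semigroup (tendsto_semigroup_sub_diagonal hL hζ hs)
    (fun t ht x y => (semigroup_sub_diagonal_le hL hs ht x y).1) x y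

lemma resolvent_nonneg (hL : IsSubMarkovGenerator L) (hζ : HasFiniteLifetime L)
    (hs : 0 ≤ s) (x y : X) : 0 ≤ resolvent L s x y := by
  rw [← (integral_semigroup_sub_diagonal hL hζ hs x y).2]
  exact setIntegral_nonneg measurableSet_Ioi fun t ht =>
    (semigroup_sub_diagonal_le hL hs (le_of_lt ht) x y).1

/-- Uniformization: `q` only has to dominate the diagonal rates. -/
lemma exists_one_add_smul_nonneg (hL : IsSubMarkovGenerator L) :
    ∃ q : ℝ, 0 < q ∧ ∀ x y, 0 ≤ (1 + q⁻¹ • L) x y := by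
  have hpos : (0 : ℝ) < 1 + ∑ z, |L z z| :=
    add_pos_of_pos_of_nonneg one_pos (Finset.sum_nonneg fun _ _ => abs_nonneg _)
  refine ⟨1 + ∑ z, |L z z|, hpos, fun x y => ?_⟩
  by_cases h : x = y
  · subst h
    have h1 : |L x x| ≤ ∑ z, |L z z| := Finset.single_le_sum (f := fun z => |L z z|)
      (fun z _ => abs_nonneg _) (Finset.mem_univ x)
    have h2 := neg_abs_le (L x x)
    have h3 : 0 ≤ (1 + ∑ z, |L z z|)⁻¹ * ((1 + ∑ z, |L z z|) + L x x) :=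
      mul_nonneg (inv_pos.mpr hpos).le (by linarith)
    rw [mul_add, inv_mul_cancel₀ hpos.ne'] at h3
    simpa using h3
  · simpa [Matrix.one_apply, h] using mul_nonneg (inv_pos.mpr hpos).le (hL.offDiag_nonneg x y h)

/-- Here `s` enters only through `q + s x` and `q / (q + s x)`; the latter is the transform of an
exponential law, which is why this factorization is chosen. -/
lemma neg_add_diagonal_eq (L : Matrix X X ℝ) {q : ℝ} (hq : 0 < q) (hs : 0 ≤ s) :
    -L + Matrix.diagonal s = Matrix.diagonal (fun x => q + s x) *
      (1 - Matrix.diagonal (fun x => q / (q + s x)) * (1 + q⁻¹ • L)) := by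
  rw [mul_sub, ← mul_assoc, Matrix.diagonal_mul_diagonal, mul_one]
  have : ∀ x, (q + s x) * (q / (q + s x)) = q := fun x =>
    mul_div_cancel₀ _ (add_pos_of_pos_of_nonneg hq (hs x)).ne'
  simp only [this]
  ext x y
  by_cases h : x = y
  · subst h
    simp
    field_simp
    ring
  · simp [h, mul_inv_cancel_left₀ hq.ne']

/-- The logarithm of the determinant of `-L + M_s`, as a series in closed paths. -/
lemma det_neg_add_diagonal (hL : IsSubMarkovGenerator L) (hζ : HasFiniteLifetime L)
    (hs : 0 ≤ s) {q : ℝ} (hq : 0 < q) (hq' : ∀ x y, 0 ≤ (1 + q⁻¹ • L) x y) :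
    (Summable fun k : ℕ => ((Matrix.diagonal (fun x => q / (q + s x)) * (1 + q⁻¹ • L)) ^
        (k + 1)).trace / (k + 1)) ∧
      (-L + Matrix.diagonal s).det = (∏ x, (q + s x)) * Real.exp (-∑' k : ℕ,
        ((Matrix.diagonal (fun x => q / (q + s x)) * (1 + q⁻¹ • L)) ^ (k + 1)).trace /
          (k + 1)) := by
  have hqs : ∀ x, 0 < q + s x := fun x => add_pos_of_pos_of_nonneg hq (hs x)
  have hA : ∀ x y, 0 ≤ (Matrix.diagonal (fun x => q / (q + s x)) * (1 + q⁻¹ • L)) x y :=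
    fun x y => by
      rw [Matrix.diagonal_mul]
      exact mul_nonneg (div_nonneg hq.le (hqs x).le) (hq' x y)
  have hN : ∀ x y, 0 ≤ (resolvent L s * Matrix.diagonal (fun x => q + s x)) x y := fun x y => by
    rw [Matrix.mul_diagonal]
    exact mul_nonneg (resolvent_nonneg hL hζ hs x y) (hqs y).le
  have hNA : resolvent L s * Matrix.diagonal (fun x => q + s x) *
      (1 - Matrix.diagonal (fun x => q / (q + s x)) * (1 + q⁻¹ • L)) = 1 := by
    rw [mul_assoc, ← neg_add_diagonal_eq L hq hs]
    exact Matrix.nonsing_inv_mul _ (isUnit_det_neg_add_diagonal hL hζ hs)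
  obtain ⟨h1, h2⟩ := det_one_sub_mul_exp_tsum_trace hA hN hNA
  refine ⟨h1, ?_⟩
  rw [neg_add_diagonal_eq L hq hs, Matrix.det_mul, Matrix.det_diagonal, Real.exp_neg,
    ← eq_inv_of_mul_eq_one_left h2]

lemma det_neg_add_diagonal_pos (hL : IsSubMarkovGenerator L) (hζ : HasFiniteLifetime L)
    (hs : 0 ≤ s) : 0 < (-L + Matrix.diagonal s).det := by
  obtain ⟨q, hq, hq'⟩ := exists_one_add_smul_nonneg hL
  rw [(det_neg_add_diagonal hL hζ hs hq hq').2]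
  exact mul_pos (Finset.prod_pos fun x _ => add_pos_of_pos_of_nonneg hq (hs x)) (Real.exp_pos _)

lemma det_neg_pos (hL : IsSubMarkovGenerator L) (hζ : HasFiniteLifetime L) : 0 < (-L).det := by
  simpa using det_neg_add_diagonal_pos hL hζ (le_refl (0 : X → ℝ))

lemma laplaceRatio_zero (hL : IsSubMarkovGenerator L) (hζ : HasFiniteLifetime L) :
    laplaceRatio L 0 = 1 := by
  unfold laplaceRatio
  rw [show Matrix.diagonal (0 : X → ℝ) = 0 from Matrix.diagonal_zero, add_zero,
    div_self (det_neg_pos hL hζ).ne']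

lemma laplaceRatio_pos (hL : IsSubMarkovGenerator L) (hζ : HasFiniteLifetime L) (hs : 0 ≤ s) :
    0 < laplaceRatio L s :=
  div_pos (det_neg_pos hL hζ) (det_neg_add_diagonal_pos hL hζ hs)

/-- Every positive root of `Φ` is a Laplace transform. -/
theorem exists_isLaplace_pow_eq {m : X → ℝ} (hm : ∀ x, 0 < m x) (hL : IsSubMarkovGenerator L)
    (hζ : HasFiniteLifetime L) {n : ℕ} (hn : 0 < n) :
    ∃ χ, IsLaplace m χ ∧ ∀ s, 0 ≤ s → χ s ^ n = laplaceRatio L s := by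
  obtain ⟨q, hq, hq'⟩ := exists_one_add_smul_nonneg hL
  set A : (X → ℝ) → Matrix X X ℝ := fun s =>
    Matrix.diagonal (fun x => q / (q + s x)) * (1 + q⁻¹ • L) with hAdef
  set ψ : (X → ℝ) → ℝ := fun s => ∑' k : ℕ, (A s ^ (k + 1)).trace / (k + 1) with hψ
  have hdet : ∀ s, 0 ≤ s → (-L + Matrix.diagonal s).det = (∏ x, (q + s x)) * Real.exp (-ψ s) :=
    fun s hs => (det_neg_add_diagonal hL hζ hs hq hq').2
  have hA : ∀ x y, IsLaplace m fun s => A s x y := fun x y => by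
    refine ((IsLaplace.gamma hm x hq one_pos).mul (IsLaplace.const (hq' x y))).congr fun s _ => ?_
    rw [Real.rpow_one]
    exact (Matrix.diagonal_mul (fun x => q / (q + s x)) (1 + q⁻¹ • L) x y).symm
  have hApow : ∀ (k : ℕ) (x y : X), IsLaplace m fun s => (A s ^ k) x y := by
    intro k
    induction k with
    | zero => exact fun x y => (IsLaplace.const (one_apply_nonneg x y)).congr fun s _ => by simp
    | succ k ih =>
      intro x y
      refine (IsLaplace.sum fun z => (ih x z).mul (hA z y)).congr fun s _ => ?_
      rw [pow_succ, Matrix.mul_apply]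
  have hψL : IsLaplace m ψ := by
    refine IsLaplace.tsum (fun k => ?_) fun s hs => (det_neg_add_diagonal hL hζ hs hq hq').1
    refine ((IsLaplace.const (c := ((k : ℝ) + 1)⁻¹) (by positivity)).mul
      (IsLaplace.sum fun x => hApow (k + 1) x x)).congr fun s _ => ?_
    rw [Matrix.trace, div_eq_inv_mul]
    rfl
  have hn' : (n : ℝ) ≠ 0 := by positivity
  -- The n-th root is taken factor by factor: gamma laws of shape `1/n`, the trace series divided by
  -- `n`, and a positive constant from `det (-L)`.
  refine ⟨fun s => (∏ x, (q / (q + s x)) ^ (n : ℝ)⁻¹) *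
    (Real.exp ((n : ℝ)⁻¹ * ψ s) * Real.exp (-((n : ℝ)⁻¹ * ψ 0))), ?_, fun s hs => ?_⟩
  · exact (IsLaplace.prod Finset.univ fun x => IsLaplace.gamma hm x hq (by positivity)).mul
      ((((IsLaplace.const (by positivity)).mul hψL).exp).mul (IsLaplace.const (Real.exp_pos _).le))
  · have hqs : ∀ x, 0 < q + s x := fun x => add_pos_of_pos_of_nonneg hq (hs x)
    have h0 : (-L).det = (∏ _x : X, q) * Real.exp (-ψ 0) := by
      simpa using hdet 0 le_rfl
    unfold laplaceRatio
    rw [h0, hdet s hs, mul_pow, ← Finset.prod_pow, mul_pow, ← Real.exp_nat_mul, ← Real.exp_nat_mul]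
    have h1 : ∀ x, ((q / (q + s x)) ^ (n : ℝ)⁻¹) ^ n = q / (q + s x) := fun x =>
      Real.rpow_inv_natCast_pow (div_pos hq (hqs x)).le hn.ne'
    have h2 : ∏ x, (q + s x) ≠ 0 := Finset.prod_ne_zero_iff.mpr fun x _ => (hqs x).ne'
    simp only [h1, Finset.prod_div_distrib]
    rw [mul_inv_cancel_left₀ hn', mul_neg, mul_inv_cancel_left₀ hn', Real.exp_neg (ψ s)]
    field_simp

/-- The reference measure charges every point. -/
lemma refMeasure_pos (hL : IsSubMarkovGenerator L) (hζ : HasFiniteLifetime L) {μ : X → ℝ}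
    (hμ : ∀ x, 0 ≤ μ x) (hreach : ∀ x, ∃ y, 0 < μ y ∧ Reaches L y x) (x : X) :
    0 < refMeasure L μ x := by
  have hV : ∀ x y, 0 ≤ potential L x y := fun x y => by
    simpa [resolvent, potential] using resolvent_nonneg hL hζ (le_refl (0 : X → ℝ)) x y
  have hVL : potential L * -L = 1 := by
    have := isUnit_det_neg_add_diagonal hL hζ (le_refl (0 : X → ℝ))
    refine Matrix.nonsing_inv_mul _ ?_
    simpa using this
  -- The column equation of `V (-L) = 1` has nonnegative terms on the right: it starts positivity at
  -- `V y y` and propagates it along every jump of positive rate.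
  have hcol : ∀ x y, potential L x y * -L y y = (1 : Matrix X X ℝ) x y +
      ∑ z ∈ Finset.univ.erase y, potential L x z * L z y := fun x y => by
    have := congrFun (congrFun hVL x) y
    rw [Matrix.mul_apply, ← Finset.add_sum_erase _ _ (Finset.mem_univ y)] at this
    simp only [Matrix.neg_apply, mul_neg, Finset.sum_neg_distrib] at this ⊢
    linarith
  have hsum0 : ∀ x y, ∀ z ∈ Finset.univ.erase y, 0 ≤ potential L x z * L z y := fun x y z hz =>
    mul_nonneg (hV x z) (hL.offDiag_nonneg z y (Finset.ne_of_mem_erase hz))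
  have hpos : ∀ x y, 0 < potential L x y * -L y y → 0 < potential L x y := fun x y h => by
    refine (hV x y).lt_of_ne fun h0 => ?_
    rw [← h0, zero_mul] at h
    exact lt_irrefl _ h
  have hreachV : ∀ y x, Reaches L y x → 0 < potential L y x := fun y x h => by
    induction h with
    | refl =>
      refine hpos y y ?_
      rw [hcol, Matrix.one_apply_eq]
      exact add_pos_of_pos_of_nonneg one_pos (Finset.sum_nonneg (hsum0 y y))
    | @tail b c _ hbc ih =>
      by_cases hbc' : b = c
      · exact hbc' ▸ ih
      · refine hpos y c ?_
        rw [hcol]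
        refine add_pos_of_nonneg_of_pos (one_apply_nonneg y c) ?_
        exact (mul_pos ih hbc).trans_le (Finset.single_le_sum (hsum0 y c)
          (Finset.mem_erase.mpr ⟨hbc', Finset.mem_univ b⟩))
  obtain ⟨y, hy, hyx⟩ := hreach x
  exact (mul_pos hy (hreachV y x hyx)).trans_le
    (Finset.single_le_sum (f := fun y => μ y * potential L y x)
      (fun z _ => mul_nonneg (hμ z) (hV z x)) (Finset.mem_univ y))

end Resolvent

end Dynkin

end

noncomputable section

namespace Dynkin

open scoped ContDiff

/-! ### Complete monotonicity of `Φ`. -/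

section CompleteMonotonicity

variable {X : Type*} [Fintype X] [DecidableEq X]

lemma contDiff_det {E : Type*} [NormedAddCommGroup E] [NormedSpace ℝ E] {n : WithTop ℕ∞}
    {B : E → Matrix X X ℝ} (hB : ∀ x y, ContDiff ℝ n fun e => B e x y) :
    ContDiff ℝ n fun e => (B e).det := by
  simp only [Matrix.det_apply']
  exact ContDiff.sum fun σ _ => contDiff_const.mul (contDiff_prod fun x _ => hB _ x)

lemma contDiff_neg_add_diagonal_apply (L : Matrix X X ℝ) {n : WithTop ℕ∞} (x y : X) :
    ContDiff ℝ n fun s : X → ℝ => (-L + Matrix.diagonal s) x y := by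
  simp only [Matrix.add_apply]
  refine contDiff_const.add ?_
  by_cases h : x = y
  · subst h; simpa using contDiff_apply ℝ ℝ x
  · simpa [h] using contDiff_const

lemma contDiff_det_neg_add_diagonal (L : Matrix X X ℝ) {n : WithTop ℕ∞} :
    ContDiff ℝ n fun s : X → ℝ => (-L + Matrix.diagonal s).det :=
  contDiff_det (contDiff_neg_add_diagonal_apply L)

/-- By the adjugate formula, the entries are rational in `s` with denominator the determinant. -/
lemma contDiffAt_resolvent {L : Matrix X X ℝ} {n : WithTop ℕ∞} {s : X → ℝ}
    (h : (-L + Matrix.diagonal s).det ≠ 0) (x y : X) :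
    ContDiffAt ℝ n (fun s => resolvent L s x y) s := by
  have hadj : ContDiff ℝ n fun s : X → ℝ => (-L + Matrix.diagonal s).adjugate x y := by
    simp only [Matrix.adjugate_apply]
    refine contDiff_det fun z w => ?_
    by_cases hz : z = y
    · subst hz; simpa using contDiff_const
    · simp only [Matrix.updateRow_apply, if_neg hz]
      exact contDiff_neg_add_diagonal_apply L z w
  have : (fun s => resolvent L s x y) = fun s =>
      (-L + Matrix.diagonal s).det⁻¹ * (-L + Matrix.diagonal s).adjugate x y := by
    funext s
    rw [resolvent, Matrix.inv_def, Matrix.smul_apply, smul_eq_mul, Ring.inverse_eq_inv']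
  rw [this]
  exact ((contDiff_det_neg_add_diagonal L).contDiffAt.inv h).mul hadj.contDiffAt

lemma hasDerivAt_det_add_smul_diagonal {B : Matrix X X ℝ} (hB : IsUnit B.det) (v : X → ℝ) :
    HasDerivAt (fun h : ℝ => (B + h • Matrix.diagonal v).det)
      (B.det * ∑ x, B⁻¹ x x * v x) 0 := by
  have h1 : ∀ h : ℝ, (B + h • Matrix.diagonal v).det =
      B.det * (1 + h • (B⁻¹ * Matrix.diagonal v)).det := fun h => by
    rw [← Matrix.det_mul, mul_add, mul_one, mul_smul_comm, ← mul_assoc,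
      Matrix.mul_nonsing_inv _ hB, one_mul]
  have h2 : (B⁻¹ * Matrix.diagonal v).trace = ∑ x, B⁻¹ x x * v x := by
    simp only [Matrix.trace, Matrix.diag, Matrix.mul_diagonal]
  rw [funext h1, ← h2]
  exact (hasDerivAt_det_one_add_smul _).const_mul _

lemma neg_add_diagonal_add_smul {X : Type*} [DecidableEq X] (L : Matrix X X ℝ) (s v : X → ℝ) (h : ℝ) :
    -L + Matrix.diagonal (s + h • v) = -L + Matrix.diagonal s + h • Matrix.diagonal v := by
  rw [add_assoc, ← Matrix.diagonal_smul, Matrix.diagonal_add]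
  rfl

lemma hasDerivAt_laplaceRatio {L : Matrix X X ℝ} {s : X → ℝ}
    (hB : IsUnit (-L + Matrix.diagonal s).det) (v : X → ℝ) :
    HasDerivAt (fun h : ℝ => laplaceRatio L (s + h • v))
      (-(laplaceRatio L s * ∑ x, resolvent L s x x * v x)) 0 := by
  have hB0 := hB.ne_zero
  unfold laplaceRatio resolvent
  simp only [neg_add_diagonal_add_smul]
  have h := (hasDerivAt_const (0 : ℝ) (-L).det).div (hasDerivAt_det_add_smul_diagonal hB v)
    (by simpa using hB0)
  convert! h using 1
  simp only [zero_smul, add_zero]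
  field_simp
  ring

lemma hasDerivAt_resolvent {L : Matrix X X ℝ} {s : X → ℝ}
    (hB : IsUnit (-L + Matrix.diagonal s).det) (v : X → ℝ) (x y : X) :
    HasDerivAt (fun h : ℝ => resolvent L (s + h • v) x y)
      (-∑ z, resolvent L s x z * v z * resolvent L s z y) 0 := by
  have hcont : Continuous fun h : ℝ => (-L + Matrix.diagonal (s + h • v)).det :=
    (contDiff_det_neg_add_diagonal L (n := 0)).continuous.comp (by fun_prop)
  have hev : ∀ᶠ h : ℝ in 𝓝 0, (-L + Matrix.diagonal (s + h • v)).det ≠ 0 :=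
    hcont.continuousAt.eventually_ne (by simpa using hB.ne_zero)
  -- The resolvent identity has the form `R(h) = R(0) - h k(h)`, so the derivative at `0` is
  -- `-k(0)`.
  have heq : (fun h : ℝ => resolvent L (s + h • v) x y) =ᶠ[𝓝 0] fun h => resolvent L s x y -
      h * ∑ z, resolvent L (s + h • v) x z * v z * resolvent L s z y := by
    filter_upwards [hev] with h hh
    have h1 : resolvent L (s + h • v) = resolvent L s -
        h • (resolvent L (s + h • v) * Matrix.diagonal v * resolvent L s) := by
      have e1 : resolvent L (s + h • v) * (-L + Matrix.diagonal s + h • Matrix.diagonal v) = 1 := by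
        rw [← neg_add_diagonal_add_smul]
        exact Matrix.nonsing_inv_mul _ (isUnit_iff_ne_zero.mpr hh)
      have e2 : (-L + Matrix.diagonal s) * resolvent L s = 1 := Matrix.mul_nonsing_inv _ hB
      have e3 : resolvent L (s + h • v) * (-L + Matrix.diagonal s) =
          1 - h • (resolvent L (s + h • v) * Matrix.diagonal v) := by
        rw [← e1, mul_add _ (-L + Matrix.diagonal s), mul_smul_comm, add_sub_cancel_right]
      calc resolvent L (s + h • v)
          = resolvent L (s + h • v) * (-L + Matrix.diagonal s) * resolvent L s := by
            rw [mul_assoc, e2, mul_one]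
        _ = _ := by rw [e3, sub_mul, one_mul, smul_mul_assoc]
    have h2 := congrFun (congrFun h1 x) y
    rw [h2, Matrix.sub_apply, Matrix.smul_apply, Matrix.mul_apply, smul_eq_mul]
    simp only [Matrix.mul_diagonal]
  have hline : HasDerivAt (fun h : ℝ => s + h • v) v 0 := by
    simpa using ((hasDerivAt_id (0 : ℝ)).smul_const v).const_add s
  have hR : ∀ z, DifferentiableAt ℝ (fun h : ℝ => resolvent L (s + h • v) x z) 0 := fun z => by
    have h1 : DifferentiableAt ℝ (fun s => resolvent L s x z) (s + (0 : ℝ) • v) := by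
      simpa using (contDiffAt_resolvent hB.ne_zero x z).differentiableAt (n := 1) (by simp)
    exact DifferentiableAt.comp (0 : ℝ) h1 hline.differentiableAt
  have hk : DifferentiableAt ℝ (fun h : ℝ =>
      ∑ z, resolvent L (s + h • v) x z * v z * resolvent L s z y) 0 :=
    DifferentiableAt.fun_sum fun z _ => ((hR z).mul_const _).mul_const _
  have := ((hasDerivAt_id (0 : ℝ)).mul hk.hasDerivAt).const_sub (resolvent L s x y)
  refine (HasDerivAt.congr_of_eventuallyEq ?_ heq)
  convert! this using 1
  simp

/-- The functions generated by `Φ` and the entries of the resolvent. -/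
inductive IsResolventPolynomial (L : Matrix X X ℝ) : ((X → ℝ) → ℝ) → Prop
  | laplaceRatio : IsResolventPolynomial L (laplaceRatio L)
  | resolvent (x y : X) : IsResolventPolynomial L fun s => resolvent L s x y
  | const {c : ℝ} (hc : 0 ≤ c) : IsResolventPolynomial L fun _ => c
  | add {f g} (hf : IsResolventPolynomial L f) (hg : IsResolventPolynomial L g) :
      IsResolventPolynomial L fun s => f s + g s
  | mul {f g} (hf : IsResolventPolynomial L f) (hg : IsResolventPolynomial L g) :
      IsResolventPolynomial L fun s => f s * g s

namespace IsResolventPolynomial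

variable {L : Matrix X X ℝ} {f : (X → ℝ) → ℝ}

lemma sum {ι : Type*} (t : Finset ι) {f : ι → (X → ℝ) → ℝ}
    (hf : ∀ i, IsResolventPolynomial L (f i)) :
    IsResolventPolynomial L fun s => ∑ i ∈ t, f i s := by
  classical
  induction t using Finset.induction_on with
  | empty => simpa using const le_rfl
  | insert i t hi ih => simpa only [Finset.sum_insert hi] using (hf i).add ih

lemma nonneg (hL : IsSubMarkovGenerator L) (hζ : HasFiniteLifetime L)
    (hf : IsResolventPolynomial L f) {s : X → ℝ} (hs : 0 ≤ s) : 0 ≤ f s := by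
  induction hf with
  | laplaceRatio => exact (laplaceRatio_pos hL hζ hs).le
  | resolvent x y => exact resolvent_nonneg hL hζ hs x y
  | const hc => exact hc
  | add _ _ ihf ihg => exact add_nonneg ihf ihg
  | mul _ _ ihf ihg => exact mul_nonneg ihf ihg

lemma contDiffAt (hL : IsSubMarkovGenerator L) (hζ : HasFiniteLifetime L)
    (hf : IsResolventPolynomial L f) {s : X → ℝ} (hs : 0 ≤ s) {n : WithTop ℕ∞} :
    ContDiffAt ℝ n f s := by
  induction hf with
  | laplaceRatio =>
    exact contDiffAt_const.div (contDiff_det_neg_add_diagonal L).contDiffAt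
      (isUnit_det_neg_add_diagonal hL hζ hs).ne_zero
  | resolvent x y => exact contDiffAt_resolvent (isUnit_det_neg_add_diagonal hL hζ hs).ne_zero x y
  | const hc => exact contDiffAt_const
  | add _ _ ihf ihg => exact ihf.add ihg
  | mul _ _ ihf ihg => exact ihf.mul ihg

/-- The two derivative formulas have an overall minus sign and otherwise nonnegative coefficients,
namely the coordinates of `v`; sums and products follow by Leibniz. -/
lemma exists_fderiv_eq_neg (hL : IsSubMarkovGenerator L) (hζ : HasFiniteLifetime L)
    (hf : IsResolventPolynomial L f) {v : X → ℝ} (hv : 0 ≤ v) :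
    ∃ g, IsResolventPolynomial L g ∧ ∀ s, 0 ≤ s → fderiv ℝ f s v = -g s := by
  have line : ∀ {f : (X → ℝ) → ℝ} (_ : IsResolventPolynomial L f) {s : X → ℝ} (_ : 0 ≤ s) {d : ℝ}
      (_ : HasDerivAt (fun h : ℝ => f (s + h • v)) d 0), fderiv ℝ f s v = d := by
    intro f hf s hs d hd
    have := (hf.contDiffAt hL hζ hs (n := 1)).differentiableAt (by simp)
    rw [← this.lineDeriv_eq_fderiv]
    exact hd.deriv
  induction hf with
  | laplaceRatio =>
    refine ⟨_, laplaceRatio.mul (sum Finset.univ fun x => (resolvent x x).mul (const (hv x))),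
      fun s hs => line laplaceRatio hs ?_⟩
    exact hasDerivAt_laplaceRatio (isUnit_det_neg_add_diagonal hL hζ hs) v
  | resolvent x y =>
    refine ⟨_, sum Finset.univ fun z => ((resolvent x z).mul (const (hv z))).mul (resolvent z y),
      fun s hs => line (resolvent x y) hs ?_⟩
    exact hasDerivAt_resolvent (isUnit_det_neg_add_diagonal hL hζ hs) v x y
  | const hc => exact ⟨_, const le_rfl, fun s _ => by simp⟩
  | @add f g hf hg ihf ihg =>
    obtain ⟨f', hf', ef⟩ := ihf
    obtain ⟨g', hg', eg⟩ := ihg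
    refine ⟨_, hf'.add hg', fun s hs => ?_⟩
    rw [fderiv_fun_add ((hf.contDiffAt hL hζ hs (n := 1)).differentiableAt (by simp))
      ((hg.contDiffAt hL hζ hs (n := 1)).differentiableAt (by simp)),
      _root_.add_apply, ef s hs, eg s hs]
    ring
  | @mul f g hf hg ihf ihg =>
    obtain ⟨f', hf', ef⟩ := ihf
    obtain ⟨g', hg', eg⟩ := ihg
    refine ⟨_, (hf'.mul hg).add (hf.mul hg'), fun s hs => ?_⟩
    rw [fderiv_fun_mul ((hf.contDiffAt hL hζ hs (n := 1)).differentiableAt (by simp))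
      ((hg.contDiffAt hL hζ hs (n := 1)).differentiableAt (by simp)),
      _root_.add_apply, _root_.smul_apply,
      _root_.smul_apply, ef s hs, eg s hs]
    simp only [smul_eq_mul]
    ring

lemma uniqueDiffOn_orthant {X : Type*} [Fintype X] : UniqueDiffOn ℝ (Set.Ici (0 : X → ℝ)) := by
  rw [← Set.pi_univ_Ici]
  exact UniqueDiffOn.univ_pi fun x => uniqueDiffOn_Ici _

/-- Induction on the order: the innermost derivative, in the last direction, equals `-g` on the
orthant with `g` in the same class, and each such step contributes one sign. -/
lemma isCompletelyMonotone (hL : IsSubMarkovGenerator L) (hζ : HasFiniteLifetime L)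
    (hf : IsResolventPolynomial L f) : IsCompletelyMonotone f := by
  refine ⟨fun s hs => (hf.contDiffAt hL hζ hs).contDiffWithinAt, fun n => ?_⟩
  induction n generalizing f with
  | zero => exact fun s v hs _ => by simpa using hf.nonneg hL hζ hs
  | succ n ih =>
    intro s v hs hv
    obtain ⟨g, hg, hfg⟩ := hf.exists_fderiv_eq_neg hL hζ (hv (Fin.last n))
    have hcd : ContDiffOn ℝ n (fderivWithin ℝ f (Set.Ici 0)) (Set.Ici 0) := by
      have h1 : ContDiffOn ℝ (n + 1) f (Set.Ici 0) :=
        fun s hs => (hf.contDiffAt hL hζ hs).contDiffWithinAt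
      exact h1.fderivWithin uniqueDiffOn_orthant le_rfl
    have h2 := ContinuousLinearMap.iteratedFDerivWithin_comp_left
      (ContinuousLinearMap.apply ℝ ℝ (v (Fin.last n))) (hcd s hs) uniqueDiffOn_orthant
      (show s ∈ Set.Ici (0 : X → ℝ) from hs) le_rfl
    have h3 : Set.EqOn (ContinuousLinearMap.apply ℝ ℝ (v (Fin.last n)) ∘
        fderivWithin ℝ f (Set.Ici 0)) (-g) (Set.Ici 0) := fun u hu => by
      rw [Function.comp_apply, ContinuousLinearMap.apply_apply,
        ((hf.contDiffAt hL hζ hu (n := 1)).differentiableAt (by simp)).fderivWithin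
          (uniqueDiffOn_orthant u hu), hfg u hu]
      rfl
    have h4 := congrArg (fun T => T (Fin.init v)) h2
    simp only [ContinuousLinearMap.compContinuousMultilinearMap_coe, Function.comp_apply,
      ContinuousLinearMap.apply_apply] at h4
    rw [iteratedFDerivWithin_succ_apply_right uniqueDiffOn_orthant hs]
    change 0 ≤ (-1) ^ (n + 1) * (iteratedFDerivWithin ℝ n (fderivWithin ℝ f (Set.Ici 0))
      (Set.Ici 0) s (Fin.init v)) (v (Fin.last n))
    rw [← h4, iteratedFDerivWithin_congr h3 hs, iteratedFDerivWithin_neg_apply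
      uniqueDiffOn_orthant hs, _root_.neg_apply]
    have := ih hg s (Fin.init v) hs fun i => hv i.castSucc
    rw [pow_succ]
    linarith

end IsResolventPolynomial

end CompleteMonotonicity

end Dynkin

end

noncomputable section

namespace Dynkin

/-! ### Complex Gaussian integrals with a non-Hermitian matrix. -/

section Gaussian

open Matrix
open scoped ComplexOrder

variable {X : Type*} [Fintype X] [DecidableEq X]

lemma exists_unitary_diagonal {T : Matrix X X ℂ} (hT : T.IsHermitian) :
    ∃ U : Matrix X X ℂ, IsUnit U.det ∧ Uᴴ * U = 1 ∧
      Uᴴ * T * U = diagonal fun x => (hT.eigenvalues x : ℂ) := by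
  have h1 : (hT.eigenvectorUnitary : Matrix X X ℂ)ᴴ * (hT.eigenvectorUnitary : Matrix X X ℂ) = 1 :=
    Unitary.coe_star_mul_self hT.eigenvectorUnitary
  refine ⟨hT.eigenvectorUnitary, ?_, h1, ?_⟩
  · exact (isUnit_iff_isUnit_det _).mp (IsUnit.of_mul_eq_one_right _ h1)
  · have := hT.conjStarAlgAut_star_eigenvectorUnitary
    rw [Unitary.conjStarAlgAut_star_apply] at this
    exact this

/-- Simultaneous diagonalization by congruence of the Hermitian and skew-Hermitian parts. -/
lemma exists_congruence_diagonal {A : Matrix X X ℂ} (hA : (A + Aᴴ).PosDef) :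
    ∃ (C : Matrix X X ℂ) (b : X → ℂ), IsUnit C.det ∧ (∀ x, 0 < (b x).re) ∧
      Cᴴ * A * C = diagonal b := by
  obtain ⟨U, hU, -, hUS⟩ := exists_unitary_diagonal hA.isHermitian
  set l := hA.isHermitian.eigenvalues with hl
  have hlpos : ∀ x, 0 < l x := hA.eigenvalues_pos
  -- Rescaling the eigenvectors by `l^{-1/2}` turns the congruence of `A + Aᴴ` into the identity.
  set r : X → ℂ := fun x => ((Real.sqrt (l x))⁻¹ : ℝ) with hr
  set C₀ := U * diagonal r with hC₀
  have hrH : (diagonal r)ᴴ = diagonal r := by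
    rw [diagonal_conjTranspose]
    congr 1
    funext x
    simp [hr]
  have hrdet : IsUnit (diagonal r).det := by
    rw [det_diagonal, isUnit_iff_ne_zero, Finset.prod_ne_zero_iff]
    intro x _
    simp only [hr]
    exact_mod_cast inv_ne_zero (Real.sqrt_pos.mpr (hlpos x)).ne'
  have hS : C₀ᴴ * (A + Aᴴ) * C₀ = 1 := by
    have : C₀ᴴ * (A + Aᴴ) * C₀ = diagonal r * (Uᴴ * (A + Aᴴ) * U) * diagonal r := by
      rw [hC₀, conjTranspose_mul, hrH]
      simp only [mul_assoc]
    rw [this, hUS, diagonal_mul_diagonal, diagonal_mul_diagonal, ← diagonal_one]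
    congr 1
    funext x
    simp only [hr]
    norm_cast
    have := Real.mul_self_sqrt (hlpos x).le
    have h0 := (Real.sqrt_pos.mpr (hlpos x)).ne'
    field_simp
    linarith
  have hC₀det : IsUnit C₀.det := by
    rw [hC₀, det_mul]
    exact hU.mul hrdet
  clear_value C₀
  -- The factor `i` makes the skew part Hermitian. Its diagonalization is unitary, so it preserves
  -- the identity already obtained for `A + Aᴴ`; the final diagonal entries are `(1 - iλ)/2`, of
  -- real part `1/2`.
  set T := Complex.I • (C₀ᴴ * (A - Aᴴ) * C₀) with hTdef
  have hT : T.IsHermitian := by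
    rw [IsHermitian, hTdef, conjTranspose_smul, conjTranspose_mul, conjTranspose_mul,
      conjTranspose_conjTranspose, conjTranspose_sub, conjTranspose_conjTranspose, ← mul_assoc,
      ← neg_sub A, mul_neg, neg_mul, smul_neg, ← neg_smul]
    simp
  obtain ⟨W, hW, hWW, hWT⟩ := exists_unitary_diagonal hT
  have hdec : A = (2 : ℂ)⁻¹ • ((A + Aᴴ) + (A - Aᴴ)) := by
    rw [show (A + Aᴴ) + (A - Aᴴ) = (2 : ℂ) • A by module, smul_smul]
    norm_num
  refine ⟨C₀ * W, fun x => 2⁻¹ * (1 - Complex.I * (hT.eigenvalues x : ℂ)), ?_, fun x => ?_, ?_⟩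
  · rw [det_mul]
    exact hC₀det.mul hW
  · simp
  · have h1 : C₀ᴴ * (A - Aᴴ) * C₀ = -Complex.I • T := by
      rw [hTdef, smul_smul]
      simp
    have h2 : C₀ᴴ * A * C₀ = (2 : ℂ)⁻¹ • (1 - Complex.I • T) := by
      conv_lhs => rw [hdec]
      rw [Matrix.mul_smul, Matrix.smul_mul, mul_add, add_mul, hS, h1, neg_smul, sub_eq_add_neg]
    have h3 : (C₀ * W)ᴴ * A * (C₀ * W) = Wᴴ * (C₀ᴴ * A * C₀) * W := by
      rw [conjTranspose_mul]
      simp only [mul_assoc]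
    rw [h3, h2, Matrix.mul_smul, Matrix.smul_mul, mul_sub, sub_mul, mul_one, hWW,
      Matrix.mul_smul, Matrix.smul_mul, hWT]
    ext x y
    by_cases h : x = y
    · subst h; simp
    · simp [h]

lemma integrable_gaussian_complex {b : ℂ} (hb : 0 < b.re) :
    Integrable fun z : ℂ => Complex.exp (-(1 / 2) * (b * (starRingEnd ℂ z * z))) := by
  have h := GaussianFourier.integrable_cexp_neg_mul_sq_norm_add (V := ℂ) (b := b / 2)
    (by simpa using hb) 0 0
  refine h.congr (ae_of_all _ fun z => ?_)
  simp only [Complex.conj_mul', zero_mul, add_zero]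
  congr 1
  ring

lemma integral_gaussian_complex {b : ℂ} (hb : 0 < b.re) :
    ∫ z : ℂ, Complex.exp (-(1 / 2) * (b * (starRingEnd ℂ z * z))) = 2 * Real.pi / b := by
  have h := GaussianFourier.integral_cexp_neg_mul_sq_norm (V := ℂ) (b := b / 2)
    (by simpa using hb)
  rw [Complex.finrank_real_complex] at h
  norm_num at h
  rw [div_div_eq_mul_div] at h
  rw [mul_comm 2, ← h]
  congr 1
  funext z
  rw [Complex.conj_mul']
  congr 1
  ring

/-- The complex Gaussian integral, for a matrix with positive definite Hermitian part. -/
theorem integral_gaussian_matrix {A : Matrix X X ℂ} (hA : (A + Aᴴ).PosDef) :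
    Integrable (fun z : X → ℂ => Complex.exp (-(1 / 2) * (star z ⬝ᵥ (A *ᵥ z)))) ∧
      ∫ z : X → ℂ, Complex.exp (-(1 / 2) * (star z ⬝ᵥ (A *ᵥ z))) =
        (2 * Real.pi) ^ Fintype.card X / A.det := by
  obtain ⟨C, b, hC, hb, hCAC⟩ := exists_congruence_diagonal hA
  set g : (X → ℂ) → ℂ := fun z => Complex.exp (-(1 / 2) * (star z ⬝ᵥ (A *ᵥ z))) with hg
  have hgcont : Continuous g := by
    refine Complex.continuous_exp.comp (continuous_const.mul ?_)
    exact Continuous.dotProduct continuous_star (continuous_const.matrix_mulVec continuous_id)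
  -- The substitution by `C` splits the integral into one-dimensional ones. Its real Jacobian `|det
  -- C|²` is also the factor in `det (Cᴴ A C)`, so it cancels, and no branch of a square root is
  -- involved.
  let f : (X → ℂ) →ₗ[ℝ] (X → ℂ) := (Matrix.mulVecLin C).restrictScalars ℝ
  have hf : ∀ z, f z = C *ᵥ z := fun _ => rfl
  have hdet : LinearMap.det f = Complex.normSq C.det := by
    rw [LinearMap.det_restrictScalars, Algebra.norm_complex_apply, ← toLin'_apply',
      LinearMap.det_toLin']
  have hdetpos : 0 < LinearMap.det f := by
    rw [hdet]
    exact Complex.normSq_pos.mpr hC.ne_zero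
  have hmap := Measure.map_linearMap_addHaar_eq_smul_addHaar (volume : Measure (X → ℂ)) hdetpos.ne'
  have hfm : Measurable f := f.continuous_of_finiteDimensional.measurable
  have hgf : ∀ z, g (f z) = ∏ x, Complex.exp (-(1 / 2) * (b x * (starRingEnd ℂ (z x) * z x))) := by
    intro z
    rw [← Complex.exp_sum, ← Finset.mul_sum]
    simp only [hg, hf]
    congr 2
    rw [star_mulVec, ← dotProduct_mulVec, mulVec_mulVec, mulVec_mulVec, hCAC]
    simp only [dotProduct, mulVec_diagonal, Pi.star_apply, RCLike.star_def]
    exact Finset.sum_congr rfl fun x _ => by ring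
  have hgfi : Integrable (g ∘ f) volume := by
    rw [show g ∘ f = _ from funext hgf]
    exact Integrable.fintype_prod fun x => integrable_gaussian_complex (hb x)
  have hc : ENNReal.ofReal |(LinearMap.det f)⁻¹| ≠ 0 := by
    rw [ne_eq, ENNReal.ofReal_eq_zero, not_le]
    exact abs_pos.mpr (inv_ne_zero hdetpos.ne')
  constructor
  · have := (integrable_map_measure hgcont.aestronglyMeasurable hfm.aemeasurable).mpr hgfi
    rw [hmap] at this
    exact (integrable_smul_measure hc ENNReal.ofReal_ne_top).mp this
  · have h1 : ∫ z, g z ∂(Measure.map f volume) = ∫ z, g (f z) :=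
      integral_map hfm.aemeasurable hgcont.aestronglyMeasurable
    rw [hmap, integral_smul_measure, ENNReal.toReal_ofReal (abs_nonneg _),
      abs_of_pos (inv_pos.mpr hdetpos), funext hgf, integral_fintype_prod_volume_eq_prod (f := fun x (z : ℂ) =>
        Complex.exp (-(1 / 2) * (b x * (starRingEnd ℂ z * z))))] at h1
    simp only [integral_gaussian_complex (hb _), Finset.prod_div_distrib, Finset.prod_const,
      Finset.card_univ] at h1
    have h2 : ∏ x, b x = Complex.normSq C.det * A.det := by
      rw [← det_diagonal, ← hCAC, det_mul, det_mul, det_conjTranspose, Complex.normSq_eq_conj_mul_self]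
      simp only [RCLike.star_def]
      ring
    have hn : (Complex.normSq C.det : ℂ) ≠ 0 := by
      exact_mod_cast (Complex.normSq_pos.mpr hC.ne_zero).ne'
    rw [h2, hdet, Complex.real_smul] at h1
    push_cast at h1
    rw [inv_mul_eq_iff_eq_mul₀ hn] at h1
    rw [h1, mul_div_assoc', mul_div_mul_left _ _ hn]

end Gaussian

end Dynkin

end

noncomputable section

namespace Dynkin

open scoped ENNReal

/-! ### Uniqueness for images of real and complex densities. -/

section ImageOfDensity

variable {X : Type*} [Fintype X] {Z : Type*} [MeasurableSpace Z] {ν : Measure Z}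
  {T : Z → X → ℝ≥0} {m : X → ℝ}

lemma laplaceTransform_ne_top (hm : ∀ x, 0 < m x) {s : X → ℝ} (hs : 0 ≤ s)
    (M : Measure (X → ℝ≥0)) [IsFiniteMeasure M] : laplaceTransform m M s ≠ ∞ :=
  (integrable_laplaceKernel hm hs M).lintegral_lt_top.ne

lemma laplaceTransform_map_withDensity (hT : Measurable T) {f : Z → ℝ≥0∞} (hf : AEMeasurable f ν)
    (s : X → ℝ) : laplaceTransform m ((ν.withDensity f).map T) s =
      ∫⁻ z, f z * ENNReal.ofReal (laplaceKernel m s (T z)) ∂ν := by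
  unfold laplaceTransform
  rw [lintegral_map (by fun_prop) hT, lintegral_withDensity_eq_lintegral_mul₀ hf (by fun_prop)]
  rfl

/-- The image of a real measure with density is determined by its Laplace transform. -/
lemma setIntegral_preimage_eq_of_laplace [DecidableEq X] (hm : ∀ x, 0 < m x) (hT : Measurable T) {e : Z → ℝ}
    (he : Integrable e ν) {Q : Measure (X → ℝ≥0)} [IsFiniteMeasure Q]
    (h : ∀ s : X → ℝ, 0 ≤ s →
      ∫ z, e z * laplaceKernel m s (T z) ∂ν = ∫ ρ, laplaceKernel m s ρ ∂Q)
    {B : Set (X → ℝ≥0)} (hB : MeasurableSet B) :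
    ∫ z in T ⁻¹' B, e z ∂ν = Q.real B := by
  set p : Z → ℝ≥0∞ := fun z => ENNReal.ofReal (e z) with hp
  set n : Z → ℝ≥0∞ := fun z => ENNReal.ofReal (-e z) with hn
  have hpm : AEMeasurable p ν := he.aemeasurable.ennreal_ofReal
  have hnm : AEMeasurable n ν := he.aemeasurable.neg.ennreal_ofReal
  have hpf : IsFiniteMeasure (ν.withDensity p) :=
    isFiniteMeasure_withDensity he.lintegral_lt_top.ne
  have hnf : IsFiniteMeasure (ν.withDensity n) :=
    isFiniteMeasure_withDensity he.neg.lintegral_lt_top.ne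
  -- With the negative part moved to the other side, both members are finite positive measures and
  -- uniqueness applies.
  have key : (ν.withDensity p).map T = (ν.withDensity n).map T + Q := by
    refine ext_of_laplaceTransform hm fun s hs => ?_
    have hint : Integrable (fun z => e z * laplaceKernel m s (T z)) ν := by
      refine he.mul_bdd (c := 1) (by fun_prop) (ae_of_all _ fun z => ?_)
      rw [Real.norm_of_nonneg (laplaceKernel_pos _ _ _).le]
      exact laplaceKernel_le_one hm hs _
    have h1 := h s hs
    rw [integral_eq_lintegral_pos_part_sub_lintegral_neg_part hint, integral_laplaceKernel] at h1
    simp only [← neg_mul, ENNReal.ofReal_mul' (laplaceKernel_pos _ _ _).le] at h1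
    have hP := laplaceTransform_map_withDensity (m := m) hT hpm s
    have hN := laplaceTransform_map_withDensity (m := m) hT hnm s
    rw [← hP, ← hN] at h1
    have hadd : laplaceTransform m ((ν.withDensity n).map T + Q) s =
        laplaceTransform m ((ν.withDensity n).map T) s + laplaceTransform m Q s :=
      lintegral_add_measure _ _ _
    rw [hadd, ← ENNReal.toReal_eq_toReal_iff' (laplaceTransform_ne_top hm hs _)
      (ENNReal.add_ne_top.mpr ⟨laplaceTransform_ne_top hm hs _, laplaceTransform_ne_top hm hs _⟩),
      ENNReal.toReal_add (laplaceTransform_ne_top hm hs _) (laplaceTransform_ne_top hm hs _)]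
    linarith
  have h2 := congrArg (fun M : Measure (X → ℝ≥0) => (M B).toReal) key
  simp only [Measure.add_apply, Measure.map_apply hT hB, withDensity_apply _ (hT hB)] at h2
  rw [ENNReal.toReal_add, ← sub_eq_iff_eq_add'] at h2
  · rw [integral_eq_lintegral_pos_part_sub_lintegral_neg_part he.restrict]
    exact h2
  · exact ne_top_of_le_ne_top he.neg.lintegral_lt_top.ne (setLIntegral_le_lintegral _ _)
  · exact measure_ne_top _ _

/-- The image of a complex measure with density is determined by its Laplace transform. -/
lemma setIntegral_preimage_eq_of_laplace_complex [DecidableEq X] (hm : ∀ x, 0 < m x) (hT : Measurable T)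
    {d : Z → ℂ} (hd : Integrable d ν) {Q : Measure (X → ℝ≥0)} [IsFiniteMeasure Q]
    (h : ∀ s : X → ℝ, 0 ≤ s →
      ∫ z, d z * (laplaceKernel m s (T z) : ℂ) ∂ν = ((∫ ρ, laplaceKernel m s ρ ∂Q : ℝ) : ℂ))
    {B : Set (X → ℝ≥0)} (hB : MeasurableSet B) :
    ∫ z in T ⁻¹' B, d z ∂ν = ((Q.real B : ℝ) : ℂ) := by
  have hint : ∀ s : X → ℝ, 0 ≤ s →
      Integrable (fun z => d z * (laplaceKernel m s (T z) : ℂ)) ν := fun s hs => by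
    refine hd.mul_bdd (c := 1) (by fun_prop) (ae_of_all _ fun z => ?_)
    rw [Complex.norm_real, Real.norm_of_nonneg (laplaceKernel_pos _ _ _).le]
    exact laplaceKernel_le_one hm hs _
  have hre := setIntegral_preimage_eq_of_laplace hm hT hd.re (Q := Q) (fun s hs => by
    have h1 := congrArg Complex.re (h s hs)
    rw [← RCLike.re_eq_complex_re, ← integral_re (hint s hs)] at h1
    simpa using h1) hB
  -- The prescribed transform is real, so the imaginary part of the density is compared with the
  -- zero measure.
  have him := setIntegral_preimage_eq_of_laplace hm hT hd.im (Q := 0) (fun s hs => by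
    have h1 := congrArg Complex.im (h s hs)
    rw [← RCLike.im_eq_complex_im, ← integral_im (hint s hs)] at h1
    simpa using h1) hB
  rw [← setIntegral_re_add_im hd.integrableOn, hre, him]
  simp

end ImageOfDensity

/-! ### Positivity of the energy form and the Laplace transform of the twisted Gaussian. -/

section TwistedGaussian

variable {X : Type*} [Fintype X] [DecidableEq X] {L : Matrix X X ℝ} {μ m s : X → ℝ}

lemma vecMul_refMeasure (hL : IsSubMarkovGenerator L) (hζ : HasFiniteLifetime L) :
    Matrix.vecMul (refMeasure L μ) L = -μ := by
  have hdet : IsUnit (-L).det := by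
    simpa using isUnit_det_neg_add_diagonal hL hζ (le_refl (0 : X → ℝ))
  have : potential L * L = -1 := by
    rw [← neg_neg (potential L * L), ← mul_neg]
    congr 1
    exact Matrix.nonsing_inv_mul _ hdet
  rw [refMeasure, Matrix.vecMul_vecMul, this, Matrix.vecMul_neg, Matrix.vecMul_one]

/-- The symmetric part of `-L` in `ℓ²(m)` is a Dirichlet form. -/
lemma two_mul_sum_eq (hμ : Matrix.vecMul m L = -μ) (a : X → ℝ) :
    2 * ∑ x, m x * a x * ∑ y, (-L + Matrix.diagonal s) x y * a y =
      ∑ x, ∑ y, m x * L x y * (a x - a y) ^ 2 + ∑ x, m x * (-∑ y, L x y) * a x ^ 2 +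
        ∑ x, μ x * a x ^ 2 + 2 * ∑ x, m x * s x * a x ^ 2 := by
  have h1 : ∀ y, ∑ x, m x * L x y = -μ y := fun y => congrFun hμ y
  have h2 : ∑ x, ∑ y, m x * L x y * (a x - a y) ^ 2 =
      ∑ x, m x * (∑ y, L x y) * a x ^ 2 - ∑ x, μ x * a x ^ 2 -
        2 * ∑ x, ∑ y, m x * a x * (L x y * a y) := by
    have h3 : ∑ x, μ x * a x ^ 2 = -∑ x, ∑ y, m x * L x y * a y ^ 2 := by
      rw [Finset.sum_comm, ← Finset.sum_neg_distrib]
      refine Finset.sum_congr rfl fun y _ => ?_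
      rw [← Finset.sum_mul, h1]
      ring
    rw [h3, Finset.mul_sum, sub_neg_eq_add, ← Finset.sum_add_distrib, ← Finset.sum_sub_distrib]
    refine Finset.sum_congr rfl fun x _ => ?_
    rw [Finset.mul_sum, Finset.mul_sum, Finset.sum_mul, ← Finset.sum_add_distrib,
      ← Finset.sum_sub_distrib]
    exact Finset.sum_congr rfl fun y _ => by ring
  have h4 : ∀ x, m x * a x * ∑ y, (-L + Matrix.diagonal s) x y * a y =
      m x * s x * a x ^ 2 - ∑ y, m x * a x * (L x y * a y) := fun x => by
    simp only [Matrix.add_apply, Matrix.neg_apply, add_mul, Finset.sum_add_distrib,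
      Matrix.diagonal_apply, ite_mul, zero_mul, Finset.sum_ite_eq, Finset.mem_univ, if_true,
      neg_mul, Finset.sum_neg_distrib, ← Finset.mul_sum]
    ring
  rw [h2]
  simp only [h4, Finset.sum_sub_distrib, mul_neg, neg_mul, Finset.sum_neg_distrib]
  ring

/-- All four terms of `two_mul_sum_eq` are nonnegative. If the form failed to be positive, `a` would
be constant along jumps and zero wherever `μ` charges, hence zero everywhere by reachability. -/
lemma sum_mul_sum_pos (hL : IsSubMarkovGenerator L) (hμ0 : ∀ x, 0 ≤ μ x)
    (hreach : ∀ x, ∃ y, 0 < μ y ∧ Reaches L y x) (hm : ∀ x, 0 < m x)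
    (hμ : Matrix.vecMul m L = -μ) (hs : 0 ≤ s) {a : X → ℝ} (ha : a ≠ 0) :
    0 < ∑ x, m x * a x * ∑ y, (-L + Matrix.diagonal s) x y * a y := by
  have hkey := two_mul_sum_eq (s := s) hμ a
  have t1 : ∀ x y, 0 ≤ m x * L x y * (a x - a y) ^ 2 := fun x y => by
    by_cases h : x = y
    · simp [h]
    · exact mul_nonneg (mul_nonneg (hm x).le (hL.offDiag_nonneg x y h)) (sq_nonneg _)
  have t1' : ∀ x, 0 ≤ ∑ y, m x * L x y * (a x - a y) ^ 2 := fun x =>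
    Finset.sum_nonneg fun y _ => t1 x y
  have t2 : 0 ≤ ∑ x, m x * (-∑ y, L x y) * a x ^ 2 := Finset.sum_nonneg fun x _ =>
    mul_nonneg (mul_nonneg (hm x).le (neg_nonneg.mpr (hL.rowSum_nonpos x))) (sq_nonneg _)
  have t3 : ∀ x, 0 ≤ μ x * a x ^ 2 := fun x => mul_nonneg (hμ0 x) (sq_nonneg _)
  have t4 : 0 ≤ ∑ x, m x * s x * a x ^ 2 := Finset.sum_nonneg fun x _ =>
    mul_nonneg (mul_nonneg (hm x).le (hs x)) (sq_nonneg _)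
  have t1s : 0 ≤ ∑ x, ∑ y, m x * L x y * (a x - a y) ^ 2 := Finset.sum_nonneg fun x _ => t1' x
  have t3s : 0 ≤ ∑ x, μ x * a x ^ 2 := Finset.sum_nonneg fun x _ => t3 x
  by_contra hneg
  have z1 : ∑ x, ∑ y, m x * L x y * (a x - a y) ^ 2 = 0 := by linarith
  have z3 : ∑ x, μ x * a x ^ 2 = 0 := by linarith
  have e1 : ∀ x y, 0 < L x y → a x = a y := fun x y hxy => by
    have h1 := (Finset.sum_eq_zero_iff_of_nonneg fun x _ => t1' x).mp z1 x (Finset.mem_univ x)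
    have h2 := (Finset.sum_eq_zero_iff_of_nonneg fun y _ => t1 x y).mp h1 y (Finset.mem_univ y)
    have h3 := (mul_eq_zero.mp h2).resolve_left (mul_pos (hm x) hxy).ne'
    exact sub_eq_zero.mp (pow_eq_zero_iff two_ne_zero |>.mp h3)
  have e3 : ∀ x, 0 < μ x → a x = 0 := fun x hx => by
    have h1 := (Finset.sum_eq_zero_iff_of_nonneg fun x _ => t3 x).mp z3 x (Finset.mem_univ x)
    exact pow_eq_zero_iff two_ne_zero |>.mp ((mul_eq_zero.mp h1).resolve_left hx.ne')
  refine ha (funext fun x => ?_)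
  obtain ⟨y, hy, hyx⟩ := hreach x
  have : a y = a x := by
    induction hyx with
    | refl => rfl
    | tail _ hbc ih => exact ih.trans (e1 _ _ hbc)
  rw [← this, e3 y hy]
  rfl

/-- The matrix `M_m (-L + M_s)`, with complex entries. -/
def gaussianMatrix (L : Matrix X X ℝ) (m s : X → ℝ) : Matrix X X ℂ :=
  (Matrix.diagonal m * (-L + Matrix.diagonal s)).map (fun r : ℝ => (r : ℂ))

lemma dotProduct_gaussianMatrix (z : X → ℂ) :
    dotProduct (star z) ((gaussianMatrix L m s).mulVec z) =
      ∑ x, ∑ y, ((m x * (-L + Matrix.diagonal s) x y : ℝ) : ℂ) *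
        (starRingEnd ℂ (z x) * z y) := by
  simp only [dotProduct, Matrix.mulVec, gaussianMatrix, Matrix.map_apply, Matrix.diagonal_mul,
    Finset.mul_sum, Pi.star_apply, RCLike.star_def]
  exact Finset.sum_congr rfl fun x _ => Finset.sum_congr rfl fun y _ => by ring

open scoped ComplexOrder in
lemma posDef_gaussianMatrix (hL : IsSubMarkovGenerator L) (hμ0 : ∀ x, 0 ≤ μ x)
    (hreach : ∀ x, ∃ y, 0 < μ y ∧ Reaches L y x) (hm : ∀ x, 0 < m x)
    (hμ : Matrix.vecMul m L = -μ) (hs : 0 ≤ s) :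
    (gaussianMatrix L m s + (gaussianMatrix L m s).conjTranspose).PosDef := by
  refine Matrix.PosDef.of_dotProduct_mulVec_pos (by
    rw [Matrix.IsHermitian, Matrix.conjTranspose_add, Matrix.conjTranspose_conjTranspose, add_comm])
    fun z hz => ?_
  set w := dotProduct (star z) ((gaussianMatrix L m s).mulVec z) with hw
  have hw' : dotProduct (star z) ((gaussianMatrix L m s).conjTranspose.mulVec z) =
      starRingEnd ℂ w := by
    rw [hw, starRingEnd_apply, Matrix.star_dotProduct, Matrix.star_mulVec,
      Matrix.dotProduct_mulVec, Matrix.conjTranspose_conjTranspose]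
  rw [Matrix.add_mulVec, dotProduct_add, hw', ← hw, Complex.add_conj]
  -- The matrix is real, so the real part of the form is the real form evaluated at `Re z` plus that
  -- at `Im z`, with no symmetry needed.
  have hre : w.re = ∑ x, m x * (z x).re * ∑ y, (-L + Matrix.diagonal s) x y * (z y).re +
      ∑ x, m x * (z x).im * ∑ y, (-L + Matrix.diagonal s) x y * (z y).im := by
    rw [hw, dotProduct_gaussianMatrix, Complex.re_sum, ← Finset.sum_add_distrib]
    refine Finset.sum_congr rfl fun x _ => ?_
    rw [Complex.re_sum, Finset.mul_sum, Finset.mul_sum, ← Finset.sum_add_distrib]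
    refine Finset.sum_congr rfl fun y _ => ?_
    rw [Complex.re_ofReal_mul, Complex.mul_re, Complex.conj_re, Complex.conj_im]
    ring
  have hnn : ∀ a : X → ℝ, 0 ≤ ∑ x, m x * a x * ∑ y, (-L + Matrix.diagonal s) x y * a y :=
    fun a => by
      by_cases ha : a = 0
      · simp [ha]
      · exact (sum_mul_sum_pos hL hμ0 hreach hm hμ hs ha).le
  have hpos : 0 < w.re := by
    rw [hre]
    by_cases ha : (fun x => (z x).re) = 0
    · have hb : (fun x => (z x).im) ≠ 0 := fun hb => hz <| funext fun x =>
        Complex.ext (congrFun ha x) (congrFun hb x)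
      exact add_pos_of_nonneg_of_pos (hnn fun x => (z x).re)
        (sum_mul_sum_pos hL hμ0 hreach hm hμ hs hb)
    · exact add_pos_of_pos_of_nonneg (sum_mul_sum_pos hL hμ0 hreach hm hμ hs ha)
        (hnn fun x => (z x).im)
  exact_mod_cast mul_pos two_pos hpos

/-- Since `ρ = ½ z z̄`, the Laplace weight is itself quadratic and merely replaces `-L` by `-L +
M_s` in the exponent. -/
lemma twistedGaussianDensity_mul_laplaceKernel (z : X → ℂ) :
    twistedGaussianDensity L m z * (laplaceKernel m s (halfSq z) : ℂ) =
      ((((2 * Real.pi) ^ Fintype.card X)⁻¹ * (-(Matrix.diagonal m * L)).det : ℝ) : ℂ) *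
        Complex.exp (-(1 / 2) * dotProduct (star z) ((gaussianMatrix L m s).mulVec z)) := by
  rw [twistedGaussianDensity, laplaceKernel, mul_assoc, Complex.ofReal_exp, ← Complex.exp_add]
  congr 2
  rw [dotProduct_gaussianMatrix, energy]
  push_cast
  rw [Finset.mul_sum, Finset.mul_sum, ← Finset.sum_neg_distrib, ← Finset.sum_add_distrib]
  refine Finset.sum_congr rfl fun x _ => ?_
  have h1 : ((halfSq z x : ℝ) : ℂ) = starRingEnd ℂ (z x) * z x / 2 := by
    rw [Complex.conj_mul']
    simp [halfSq]
  have h2 : ∑ y, (m x : ℂ) * ((-L + Matrix.diagonal s) x y : ℝ) * (starRingEnd ℂ (z x) * z y) =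
      -((∑ y, (L x y : ℂ) * z y) * starRingEnd ℂ (z x) * m x) +
        s x * (starRingEnd ℂ (z x) * z x) * m x := by
    have h3 : ∀ y, (m x : ℂ) * ((-L + Matrix.diagonal s) x y : ℝ) * (starRingEnd ℂ (z x) * z y) =
        -((L x y : ℂ) * z y * starRingEnd ℂ (z x) * m x) +
          if x = y then s x * (starRingEnd ℂ (z x) * z x) * m x else 0 := fun y => by
      by_cases h : x = y
      · subst h
        simp
        ring
      · simp [h]
        ring
    simp only [h3, Finset.sum_add_distrib, Finset.sum_ite_eq, Finset.mem_univ, if_true,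
      Finset.sum_neg_distrib, Finset.sum_mul]
  rw [h1, h2]
  ring

lemma measurable_halfSq {X : Type*} : Measurable (halfSq : (X → ℂ) → X → ℝ≥0) := by
  unfold halfSq
  fun_prop

/-- The Laplace transform of the twisted Gaussian measure. -/
theorem integral_twistedGaussianDensity_mul (hL : IsSubMarkovGenerator L)
    (hζ : HasFiniteLifetime L) (hμ0 : ∀ x, 0 ≤ μ x)
    (hreach : ∀ x, ∃ y, 0 < μ y ∧ Reaches L y x) (hm : ∀ x, 0 < m x)
    (hμ : Matrix.vecMul m L = -μ) (hs : 0 ≤ s) :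
    Integrable (fun z => twistedGaussianDensity L m z * (laplaceKernel m s (halfSq z) : ℂ)) ∧
      ∫ z, twistedGaussianDensity L m z * (laplaceKernel m s (halfSq z) : ℂ) =
        (laplaceRatio L s : ℂ) := by
  obtain ⟨h1, h2⟩ := integral_gaussian_matrix (posDef_gaussianMatrix hL hμ0 hreach hm hμ hs)
  simp only [twistedGaussianDensity_mul_laplaceKernel]
  refine ⟨h1.const_mul _, ?_⟩
  rw [integral_const_mul, h2]
  have h3 : (gaussianMatrix L m s).det =
      (((Matrix.diagonal m).det * (-L + Matrix.diagonal s).det : ℝ) : ℂ) := by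
    rw [← Matrix.det_mul]
    exact (RingHom.map_det Complex.ofRealHom _).symm
  rw [h3, laplaceRatio, ← mul_neg, Matrix.det_mul, Matrix.det_diagonal]
  have hm0 : ∏ x, m x ≠ 0 := Finset.prod_ne_zero_iff.mpr fun x _ => (hm x).ne'
  have hd := (det_neg_add_diagonal_pos hL hζ hs).ne'
  have hpi := Real.pi_ne_zero
  norm_cast
  field_simp

end TwistedGaussian

end Dynkin

end

noncomputable section

namespace Dynkin

open scoped ENNReal

/-! ### Sampling right-continuous paths: measurability and Riemann sums. -/

section Grid

/-- Rounding up approaches `r` from the right, the only side on which the paths are continuous. -/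
lemma tendsto_ceil_grid {t r : ℝ} (ht : 0 < t) (hr : 0 ≤ r) :
    Tendsto (fun n : ℕ => (⌈r / (t / n)⌉₊ : ℝ) * (t / n)) atTop (𝓝[≥] r) := by
  refine tendsto_nhdsWithin_iff.mpr ⟨?_, ?_⟩
  · have h1 := ((tendsto_nat_ceil_mul_div_atTop (div_nonneg hr ht.le)).comp
      (tendsto_natCast_atTop_atTop (R := ℝ))).mul_const t
    rw [div_mul_cancel₀ _ ht.ne'] at h1
    refine h1.congr fun n => ?_
    simp only [Function.comp_apply]
    rw [div_div_eq_mul_div, div_mul_eq_mul_div r t]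
    ring
  · filter_upwards [eventually_gt_atTop 0] with n hn
    have hn' : (0 : ℝ) < n := by exact_mod_cast hn
    have h2 := Nat.le_ceil (r / (t / n))
    rwa [div_le_iff₀ (by positivity)] at h2

end Grid

namespace IsMarkovProcess

variable {X : Type*} [Fintype X] [DecidableEq X] {L : Matrix X X ℝ} {Ω : Type*}
  [MeasurableSpace Ω] {P : X → Measure Ω} {ξ : ℝ → Ω → Option X}

lemma measurable_comp (h : IsMarkovProcess L P ξ) {β : Type*} [MeasurableSpace β]
    (φ : Option X → β) {t : ℝ} (ht : 0 ≤ t) : Measurable fun ω => φ (ξ t ω) := by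
  have hpt : ∀ o : Option X, MeasurableSet {ω | ξ t ω = o} := by
    intro o
    cases o with
    | some y => exact h.measurableSet_eq t ht y
    | none =>
      have : {ω | ξ t ω = none} = (⋃ y, {ω | ξ t ω = some y})ᶜ := by
        ext ω
        cases hω : ξ t ω <;> simp [hω]
      rw [this]
      exact (MeasurableSet.iUnion fun y => h.measurableSet_eq t ht y).compl
  intro B _
  have : (fun ω => φ (ξ t ω)) ⁻¹' B = ⋃ o ∈ φ ⁻¹' B, {ω | ξ t ω = o} := by
    ext ω
    simp
  rw [this]
  exact (Set.toFinite (φ ⁻¹' B)).measurableSet_biUnion fun o _ => hpt o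

lemma tendsto_comp_grid (h : IsMarkovProcess L P ξ) (φ : Option X → ℝ) {t r : ℝ} (ht : 0 < t)
    (hr : 0 ≤ r) (ω : Ω) :
    Tendsto (fun n : ℕ => φ (ξ ((⌈r / (t / n)⌉₊ : ℝ) * (t / n)) ω)) atTop (𝓝 (φ (ξ r ω))) := by
  refine tendsto_const_nhds.congr' ?_
  filter_upwards [(tendsto_ceil_grid ht hr).eventually (h.rightCont ω r hr)] with n hn
  rw [hn]

/-- Joint measurability passes to the limit from time-discretized paths. The truncation `max p.2 0`
is needed because nothing is assumed at negative times. -/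
lemma measurable_prod_comp (h : IsMarkovProcess L P ξ) (φ : Option X → ℝ) :
    Measurable fun p : Ω × ℝ => φ (ξ (max p.2 0) p.1) := by
  refine measurable_of_tendsto_metrizable
    (f := fun (n : ℕ) (p : Ω × ℝ) => φ (ξ ((⌈max p.2 0 / (1 / n)⌉₊ : ℝ) * (1 / n)) p.1))
    (fun n => ?_) (tendsto_pi_nhds.mpr fun p => h.tendsto_comp_grid φ one_pos (le_max_right _ _) _)
  have h1 : Measurable fun q : Ω × ℕ => φ (ξ ((q.2 : ℝ) * (1 / n)) q.1) :=
    measurable_from_prod_countable_left fun k => h.measurable_comp φ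
      (mul_nonneg k.cast_nonneg (one_div_nonneg.mpr n.cast_nonneg))
  have h2 : Measurable fun p : Ω × ℝ => (p.1, ⌈max p.2 0 / (1 / (n : ℝ))⌉₊) :=
    measurable_fst.prodMk (Nat.measurable_ceil.comp (by fun_prop))
  exact h1.comp h2

lemma measurableSet_graph (h : IsMarkovProcess L P ξ) (u : X) :
    MeasurableSet {p : Ω × ℝ | 0 ≤ p.2 ∧ ξ p.2 p.1 = some u} := by
  have h1 := h.measurable_prod_comp (fun o => if o = some u then 1 else 0)
  have : {p : Ω × ℝ | 0 ≤ p.2 ∧ ξ p.2 p.1 = some u} = {p : Ω × ℝ | 0 ≤ p.2} ∩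
      (fun p : Ω × ℝ => if ξ (max p.2 0) p.1 = some u then (1 : ℝ) else 0) ⁻¹' {1} := by
    ext p
    simp only [Set.mem_ofPred_eq, Set.mem_inter_iff, Set.mem_preimage, Set.mem_singleton_iff]
    refine and_congr_right fun hp => ?_
    rw [max_eq_left hp]
    by_cases hc : ξ p.2 p.1 = some u <;> simp [hc]
  rw [this]
  exact (measurableSet_le measurable_const measurable_snd).inter (h1 (measurableSet_singleton 1))

lemma measurableSet_occupation (h : IsMarkovProcess L P ξ) (ω : Ω) (t : ℝ) (u : X) :
    MeasurableSet {r : ℝ | 0 ≤ r ∧ r ≤ t ∧ ξ r ω = some u} := by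
  have h1 : MeasurableSet {r : ℝ | 0 ≤ r ∧ ξ r ω = some u} :=
    measurable_prodMk_left (h.measurableSet_graph u)
  have h2 : {r : ℝ | 0 ≤ r ∧ r ≤ t ∧ ξ r ω = some u} =
      {r : ℝ | 0 ≤ r ∧ ξ r ω = some u} ∩ Set.Iic t := by
    ext r
    simp only [Set.mem_ofPred_eq, Set.mem_inter_iff, Set.mem_Iic]
    tauto
  rw [h2]
  exact h1.inter measurableSet_Iic

lemma measurable_localTime (h : IsMarkovProcess L P ξ) (m : X → ℝ) :
    Measurable fun p : Ω × ℝ => localTime m ξ p.1 p.2 := by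
  refine measurable_pi_lambda _ fun u => ?_
  have hS : MeasurableSet {q : (Ω × ℝ) × ℝ | 0 ≤ q.2 ∧ q.2 ≤ q.1.2 ∧ ξ q.2 q.1.1 = some u} := by
    have h1 : MeasurableSet ((fun q : (Ω × ℝ) × ℝ => (q.1.1, q.2)) ⁻¹'
        {p : Ω × ℝ | 0 ≤ p.2 ∧ ξ p.2 p.1 = some u}) :=
      (measurable_fst.fst.prodMk measurable_snd) (h.measurableSet_graph u)
    have h2 : MeasurableSet {q : (Ω × ℝ) × ℝ | q.2 ≤ q.1.2} :=
      measurableSet_le measurable_snd measurable_fst.snd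
    convert! h1.inter h2 using 1
    ext q
    simp only [Set.mem_ofPred_eq, Set.mem_inter_iff, Set.mem_preimage]
    tauto
  have h3 := measurable_measure_prodMk_left (ν := (volume : Measure ℝ)) hS
  exact (h3.ennreal_toReal.const_mul _).real_toNNReal

/-- Riemann sums along a right-continuous path. -/
lemma tendsto_riemannSum (h : IsMarkovProcess L P ξ) (φ : Option X → ℝ) {t : ℝ} (ht : 0 < t)
    (ω : Ω) : Tendsto (fun n : ℕ => ∑ j ∈ Finset.range n, t / n * φ (ξ ((j + 1 : ℕ) * (t / n)) ω))
      atTop (𝓝 (∫ r in 0..t, φ (ξ r ω))) := by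
  -- The step function taking on each cell its value at the right endpoint: its integral is exactly
  -- the Riemann sum, and dominated convergence applies.
  set F : ℕ → ℝ → ℝ := fun n r => φ (ξ ((⌈r / (t / n)⌉₊ : ℝ) * (t / n)) ω) with hF
  obtain ⟨K, hK⟩ : ∃ K, ∀ o, ‖φ o‖ ≤ K :=
    ⟨∑ o, ‖φ o‖, fun o => Finset.single_le_sum (f := fun o => ‖φ o‖)
      (fun o _ => norm_nonneg _) (Finset.mem_univ o)⟩
  have hFm : ∀ n, Measurable (F n) := fun n => by
    have h1 : Measurable fun k : ℕ => φ (ξ ((k : ℝ) * (t / n)) ω) := measurable_from_top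
    exact h1.comp (Nat.measurable_ceil.comp (by fun_prop))
  have hlim : Tendsto (fun n => ∫ r in 0..t, F n r) atTop (𝓝 (∫ r in 0..t, φ (ξ r ω))) := by
    refine intervalIntegral.tendsto_integral_filter_of_dominated_convergence (fun _ => K)
      (Eventually.of_forall fun n => (hFm n).aestronglyMeasurable)
      (Eventually.of_forall fun n => ae_of_all _ fun r _ => hK _) intervalIntegrable_const
      (ae_of_all _ fun r hr => ?_)
    rw [Set.uIoc_of_le ht.le] at hr
    exact h.tendsto_comp_grid φ ht hr.1.le ω
  refine hlim.congr' ?_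
  filter_upwards [eventually_gt_atTop 0] with n hn
  have hn' : (0 : ℝ) < n := by exact_mod_cast hn
  have hh : 0 < t / n := by positivity
  have hint : ∀ a b, IntervalIntegrable (F n) volume a b := fun a b =>
    intervalIntegrable_const (c := K) |>.mono_fun (hFm n).aestronglyMeasurable
      (ae_of_all _ fun r => (hK _).trans (Real.le_norm_self K))
  have hsum := intervalIntegral.sum_integral_adjacent_intervals (f := F n)
    (a := fun k : ℕ => (k : ℝ) * (t / n)) (n := n) (fun k _ => hint _ _)
  simp only [Nat.cast_zero, zero_mul, mul_div_cancel₀ _ hn'.ne'] at hsum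
  rw [← hsum]
  refine Finset.sum_congr rfl fun j _ => ?_
  have hle : (j : ℝ) * (t / n) ≤ ((j + 1 : ℕ) : ℝ) * (t / n) := by gcongr; exact j.le_succ
  rw [intervalIntegral.integral_of_le hle, setIntegral_congr_fun (g := fun _ =>
    φ (ξ ((j + 1 : ℕ) * (t / n)) ω)) measurableSet_Ioc]
  · rw [setIntegral_const, Real.volume_real_Ioc_of_le hle, smul_eq_mul]
    congr 1
    push_cast
    ring
  · intro r hr
    have hc : ⌈r / (t / n)⌉₊ = j + 1 := by
      rw [Nat.ceil_eq_iff j.succ_ne_zero, lt_div_iff₀ hh, div_le_iff₀ hh]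
      exact hr
    simp only [hF, hc]

lemma integral_path_eq (h : IsMarkovProcess L P ξ) (s : X → ℝ) {t : ℝ} (ht : 0 ≤ t) (ω : Ω) :
    ∫ r in 0..t, (ξ r ω).elim 0 s =
      ∑ u, s u * volume.real {r : ℝ | 0 ≤ r ∧ r ≤ t ∧ ξ r ω = some u} := by
  have h1 : ∀ r ∈ Set.Icc 0 t, (ξ r ω).elim 0 s =
      ∑ u, s u * Set.indicator {r : ℝ | 0 ≤ r ∧ r ≤ t ∧ ξ r ω = some u} 1 r := fun r hr => by
    cases hω : ξ r ω with
    | none => simp [Set.indicator, hω]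
    | some y => simp [Set.indicator, hω, hr.1, hr.2]
  have hfin : ∀ u, volume {r : ℝ | 0 ≤ r ∧ r ≤ t ∧ ξ r ω = some u} ≠ ∞ := fun u =>
    ((measure_mono (t := Set.Icc 0 t) fun r hr => ⟨hr.1, hr.2.1⟩).trans_lt measure_Icc_lt_top).ne
  rw [intervalIntegral.integral_of_le ht, ← integral_Icc_eq_integral_Ioc,
    setIntegral_congr_fun measurableSet_Icc h1, integral_finsetSum]
  · refine Finset.sum_congr rfl fun u _ => ?_
    have hsub : {r : ℝ | 0 ≤ r ∧ r ≤ t ∧ ξ r ω = some u} ⊆ Set.Icc 0 t :=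
      fun r hr => ⟨hr.1, hr.2.1⟩
    rw [integral_const_mul, integral_indicator_one (h.measurableSet_occupation ω t u),
      measureReal_restrict_apply (h.measurableSet_occupation ω t u),
      Set.inter_eq_left.mpr hsub]
  · intro u _
    refine Integrable.const_mul ?_ _
    exact ((integrable_indicator_iff (h.measurableSet_occupation ω t u)).mpr
      (integrableOn_const (hfin u))).restrict

end IsMarkovProcess

end Dynkin

end

noncomputable section

namespace Dynkin

open scoped ENNReal

/-! ### The Feynman–Kac formula and the transform of the local time. -/

namespace IsMarkovProcess

variable {X : Type*} [Fintype X] [DecidableEq X] {L : Matrix X X ℝ} {Ω : Type*}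
  [MeasurableSpace Ω] {P : X → Measure Ω} {ξ : ℝ → Ω → Option X}

lemma measure_start (h : IsMarkovProcess L P ξ) (x y : X) :
    P x {ω | ξ 0 ω = some y} = if x = y then 1 else 0 := by
  have := h.isProbabilityMeasure x
  have h1 : P x {ω | ξ 0 ω = some x} = 1 := by
    have := h.finiteDimensional x 0 (fun _ => 0) (fun _ => x) (fun _ _ _ => le_rfl) rfl rfl
    simpa using this
  by_cases hxy : x = y
  · rw [if_pos hxy, ← hxy, h1]
  · rw [if_neg hxy]
    have h2 := (prob_compl_eq_zero_iff (h.measurableSet_eq 0 le_rfl x)).mpr h1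
    have hsub : {ω | ξ 0 ω = some y} ⊆ {ω | ξ 0 ω = some x}ᶜ := fun ω hω hω' =>
      hxy (Option.some_injective _ (hω'.out.symm.trans hω))
    exact measure_mono_null hsub h2

/-- The factor `1 x (y 0)` covers paths with `y 0 ≠ x`, on which `finiteDimensional` says nothing.
-/
lemma measure_grid (h : IsMarkovProcess L P ξ) {τ : ℝ} (hτ : 0 ≤ τ) (x : X) (k : ℕ) (y : ℕ → X) :
    P x {ω | ∀ i ≤ k, ξ (i * τ) ω = some (y i)} = ENNReal.ofReal
      ((1 : Matrix X X ℝ) x (y 0) * ∏ j ∈ Finset.range k, semigroup L τ (y j) (y (j + 1))) := by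
  by_cases hxy : x = y 0
  · have hmono : Monotone fun i : ℕ => (i : ℝ) * τ := fun i j hij => by
      simp only
      gcongr
    rw [h.finiteDimensional x k (fun i => i * τ) y hmono (by simp) hxy.symm, hxy,
      Matrix.one_apply_eq, one_mul]
    congr 1
    refine Finset.prod_congr rfl fun j _ => ?_
    congr 1
    push_cast
    ring
  · rw [Matrix.one_apply_ne hxy, zero_mul, ENNReal.ofReal_zero]
    refine measure_mono_null (fun ω hω => ?_) ((h.measure_start x (y 0)).trans (if_neg hxy))
    simpa using hω 0 (Nat.zero_le k)

/-- The expectation of a multiplicative functional of the process sampled on a grid. -/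
lemma lintegral_grid (h : IsMarkovProcess L P ξ) (hL : IsSubMarkovGenerator L) {τ : ℝ}
    (hτ : 0 ≤ τ) {e : X → ℝ} (he : 0 ≤ e) (x : X) (n k : ℕ) (y : ℕ → X) :
    ∫⁻ ω in {ω | ∀ i ≤ k, ξ ((n + i : ℕ) * τ) ω = some (y i)},
        ∏ j ∈ Finset.range n, ENNReal.ofReal ((ξ ((j + 1 : ℕ) * τ) ω).elim 0 e) ∂(P x) =
      ENNReal.ofReal (((semigroup L τ * Matrix.diagonal e) ^ n) x (y 0) *
        ∏ j ∈ Finset.range k, semigroup L τ (y j) (y (j + 1))) := by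
  have hPD : ∀ z w, 0 ≤ (semigroup L τ * Matrix.diagonal e) z w := fun z w => by
    rw [Matrix.mul_diagonal]
    exact mul_nonneg (semigroup_nonneg hL hτ z w) (he w)
  have hmeas : ∀ (n k : ℕ) (y : ℕ → X),
      MeasurableSet {ω | ∀ i ≤ k, ξ ((n + i : ℕ) * τ) ω = some (y i)} := fun n k y => by
    have : {ω | ∀ i ≤ k, ξ ((n + i : ℕ) * τ) ω = some (y i)} =
        ⋂ i ∈ Set.Iic k, {ω | ξ ((n + i : ℕ) * τ) ω = some (y i)} := by
      ext ω
      simp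
    rw [this]
    exact MeasurableSet.biInter (Set.to_countable _) fun i _ =>
      h.measurableSet_eq _ (by positivity) _
  -- The `k` further prescribed positions carry no weight. They make the induction run on
  -- finite-dimensional laws alone: lowering `n` by one turns a weighted time into a prescribed one.
  induction n generalizing k y with
  | zero =>
    simp only [Finset.range_zero, Finset.prod_empty, zero_add, pow_zero, lintegral_const, one_mul,
      Measure.restrict_apply MeasurableSet.univ, Set.univ_inter]
    exact h.measure_grid hτ x k y
  | succ n ih =>
    -- `c z` prepends the position `z` at time `n * τ`; such a `z` exists because a path alive at
    -- the next grid time was alive before.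
    let c : X → ℕ → X := fun z i => Nat.casesOn i z y
    have hsplit : {ω | ∀ i ≤ k, ξ ((n + 1 + i : ℕ) * τ) ω = some (y i)} =
        ⋃ z, {ω | ∀ i ≤ k + 1, ξ ((n + i : ℕ) * τ) ω = some (c z i)} := by
      ext ω
      simp only [Set.mem_ofPred_eq, Set.mem_iUnion]
      constructor
      · intro hω
        cases hz : ξ ((n : ℕ) * τ) ω with
        | none =>
          have h1 := h.absorbing ω _ (((n + 1 + 0 : ℕ) : ℝ) * τ) (by positivity)
            (by gcongr; simp) hz
          rw [hω 0 (Nat.zero_le k)] at h1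
          exact absurd h1 (by simp)
        | some z =>
          refine ⟨z, fun i hi => ?_⟩
          cases i with
          | zero => exact hz
          | succ i =>
            have := hω i (Nat.succ_le_succ_iff.mp hi)
            rwa [add_assoc, add_comm 1 i] at this
      · rintro ⟨z, hz⟩ i hi
        have hni : n + 1 + i = n + (i + 1) := by ring
        rw [hni]
        exact hz (i + 1) (Nat.succ_le_succ hi)
    have hdisj : Pairwise (Function.onFun Disjoint fun z =>
        {ω | ∀ i ≤ k + 1, ξ ((n + i : ℕ) * τ) ω = some (c z i)}) := by
      intro z w hzw
      refine Set.disjoint_left.mpr fun ω h1 h2 => hzw ?_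
      exact Option.some_injective _ ((h1 0 (Nat.zero_le _)).symm.trans (h2 0 (Nat.zero_le _)))
    rw [hsplit, lintegral_iUnion (fun z => hmeas n (k + 1) (c z)) hdisj, tsum_fintype]
    have hz : ∀ z, ∫⁻ ω in {ω | ∀ i ≤ k + 1, ξ ((n + i : ℕ) * τ) ω = some (c z i)},
        ∏ j ∈ Finset.range (n + 1), ENNReal.ofReal ((ξ ((j + 1 : ℕ) * τ) ω).elim 0 e) ∂(P x) =
        ENNReal.ofReal (((semigroup L τ * Matrix.diagonal e) ^ n) x z *
          (semigroup L τ * Matrix.diagonal e) z (y 0) *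
          ∏ j ∈ Finset.range k, semigroup L τ (y j) (y (j + 1))) := fun z => by
      rw [setLIntegral_congr_fun (g := fun ω => (∏ j ∈ Finset.range n,
        ENNReal.ofReal ((ξ ((j + 1 : ℕ) * τ) ω).elim 0 e)) * ENNReal.ofReal (e (y 0)))
        (hmeas n (k + 1) (c z))]
      · rw [lintegral_mul_const' _ _ ENNReal.ofReal_ne_top, ih (k + 1) (c z),
          ← ENNReal.ofReal_mul' (he _), Finset.prod_range_succ', Matrix.mul_diagonal]
        congr 1
        have hc0 : c z 0 = z := rfl
        have hcs : ∀ i, c z (i + 1) = y i := fun _ => rfl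
        simp only [hc0, hcs]
        ring
      · intro ω hω
        have h1 : ξ ((n + 1 : ℕ) * τ) ω = some (y 0) := hω 1 (by omega)
        simp only [Finset.prod_range_succ, h1, Option.elim_some]
    simp only [hz]
    rw [← ENNReal.ofReal_sum_of_nonneg, ← Finset.sum_mul, pow_succ, Matrix.mul_apply]
    intro z _
    exact mul_nonneg (mul_nonneg (pow_apply_nonneg hPD n x z) (hPD z (y 0)))
      (Finset.prod_nonneg fun j _ => semigroup_nonneg hL hτ _ _)

-- The Lie–Trotter formula: Chernoff's theorem for `e^{τL} e^{-τM_s}`, whose derivative at `0` is `L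
-- - M_s`.
open scoped Matrix.Norms.Operator in
lemma tendsto_semigroup_mul_diagonal_pow (L : Matrix X X ℝ) (s : X → ℝ) (t : ℝ) (x y : X) :
    Tendsto (fun n : ℕ =>
      ((semigroup L (t / n) * Matrix.diagonal fun z => Real.exp (-(t / n * s z))) ^ n) x y)
      atTop (𝓝 (semigroup (L - Matrix.diagonal s) t x y)) := by
  have : Nonempty X := ⟨x⟩
  have hD : ∀ τ : ℝ, (Matrix.diagonal fun z => Real.exp (-(τ * s z))) =
      semigroup (-Matrix.diagonal s) τ := fun τ => by
    rw [semigroup, smul_neg, ← Matrix.diagonal_smul, Matrix.diagonal_neg, Matrix.exp_diagonal]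
    congr 1
    funext z
    rw [Pi.coe_exp, Real.exp_eq_exp_ℝ]
    simp
  have hd : HasDerivAt (fun τ => semigroup L τ * semigroup (-Matrix.diagonal s) τ)
      (L - Matrix.diagonal s) 0 := by
    have := (hasDerivAt_semigroup L 0).mul (hasDerivAt_semigroup (-Matrix.diagonal s) 0)
    convert! this using 1
    simp [sub_eq_add_neg]
  have hlim := tendsto_pow_exp_of_hasDerivAt (by simp) hd t
  simp only [hD]
  exact tendsto_pi_nhds.mp (tendsto_pi_nhds.mp hlim x) y

/-- The Feynman–Kac formula. -/
theorem lintegral_exp_occupation (h : IsMarkovProcess L P ξ) (hL : IsSubMarkovGenerator L)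
    {s : X → ℝ} (hs : 0 ≤ s) {t : ℝ} (ht : 0 < t) (x y : X) :
    ∫⁻ ω in {ω | ξ t ω = some y}, ENNReal.ofReal (Real.exp
        (-∑ u, s u * volume.real {r : ℝ | 0 ≤ r ∧ r ≤ t ∧ ξ r ω = some u})) ∂(P x) =
      ENNReal.ofReal (semigroup (L - Matrix.diagonal s) t x y) := by
  have := h.isProbabilityMeasure x
  have hms : MeasurableSet {ω | ξ t ω = some y} := h.measurableSet_eq t ht.le y
  set e : ℕ → X → ℝ := fun n z => Real.exp (-(t / n * s z)) with he
  have he0 : ∀ n, 0 ≤ e n := fun n z => (Real.exp_pos _).le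
  have he1 : ∀ n (o : Option X), o.elim 0 (e n) ≤ 1 := fun n o => by
    cases o with
    | none => exact zero_le_one
    | some z =>
      exact Real.exp_le_one_iff.mpr (neg_nonpos.mpr (mul_nonneg (by positivity) (hs z)))
  set f : ℕ → Ω → ℝ≥0∞ := fun n ω =>
    ∏ j ∈ Finset.range n, ENNReal.ofReal ((ξ ((j + 1 : ℕ) * (t / n)) ω).elim 0 (e n)) with hf
  have hfm : ∀ n, Measurable (f n) := fun n => by
    refine Finset.measurable_fun_prod _ fun j _ => ?_
    exact h.measurable_comp (fun o => ENNReal.ofReal (o.elim 0 (e n)))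
      (mul_nonneg (Nat.cast_nonneg _) (div_nonneg ht.le n.cast_nonneg))
  have hval : ∀ᶠ n : ℕ in atTop, ENNReal.ofReal
      (((semigroup L (t / n) * Matrix.diagonal (e n)) ^ n) x y) =
        ∫⁻ ω in {ω | ξ t ω = some y}, f n ω ∂(P x) := by
    filter_upwards [eventually_gt_atTop 0] with n hn
    have hn' : (n : ℝ) ≠ 0 := by positivity
    have := h.lintegral_grid hL (τ := t / n) (by positivity) (he0 n) x n 0 fun _ => y
    simp only [Finset.range_zero, Finset.prod_empty, mul_one] at this
    rw [← this]
    congr 2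
    ext ω
    simp [mul_div_cancel₀ _ hn']
  have hlim1 : Tendsto (fun n : ℕ => ∫⁻ ω in {ω | ξ t ω = some y}, f n ω ∂(P x)) atTop
      (𝓝 (ENNReal.ofReal (semigroup (L - Matrix.diagonal s) t x y))) :=
    ((ENNReal.continuous_ofReal.tendsto _).comp
      (tendsto_semigroup_mul_diagonal_pow L s t x y)).congr' hval
  refine tendsto_nhds_unique ?_ hlim1
  refine tendsto_lintegral_of_dominated_convergence (fun _ => 1) hfm (fun n => ae_of_all _ fun ω =>
    Finset.prod_le_one' fun j _ => ENNReal.ofReal_le_one.mpr (he1 n _)) (by simp) ?_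
  refine (ae_restrict_iff' hms).mpr (ae_of_all _ fun ω hω => ?_)
  have hriem := h.tendsto_riemannSum (fun o => o.elim 0 s) ht ω
  rw [h.integral_path_eq s ht.le ω] at hriem
  refine ((ENNReal.continuous_ofReal.comp (Real.continuous_exp.comp continuous_neg)).tendsto _
    |>.comp hriem).congr' ?_
  filter_upwards [eventually_gt_atTop 0] with n hn
  have hn' : (0 : ℝ) < n := by positivity
  -- Being alive at `t` means being alive at all grid times, so the cemetery values `0` of both
  -- `elim`s, which are not matched by the exponential, never occur.
  have hlive : ∀ j ∈ Finset.range n, ∃ z, ξ ((j + 1 : ℕ) * (t / n)) ω = some z := fun j hj => by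
    cases hz : ξ ((j + 1 : ℕ) * (t / n)) ω with
    | some z => exact ⟨z, rfl⟩
    | none =>
      have hle : ((j + 1 : ℕ) : ℝ) * (t / n) ≤ t := by
        have : ((j + 1 : ℕ) : ℝ) ≤ n := by exact_mod_cast Finset.mem_range.mp hj
        calc ((j + 1 : ℕ) : ℝ) * (t / n) ≤ n * (t / n) := by gcongr
          _ = t := mul_div_cancel₀ _ hn'.ne'
      have h1 := h.absorbing ω _ t (by positivity) hle hz
      exact absurd (h1.symm.trans hω) (by simp)
  simp only [Function.comp_apply, hf]
  rw [← Finset.sum_neg_distrib, Real.exp_sum, ENNReal.ofReal_prod_of_nonneg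
    fun _ _ => (Real.exp_pos _).le]
  refine Finset.prod_congr rfl fun j hj => ?_
  obtain ⟨z, hz⟩ := hlive j hj
  simp only [hz, Option.elim_some, he]

/-- The Laplace transform of the local time under the path measure. -/
theorem lintegral_laplaceKernel_localTime (h : IsMarkovProcess L P ξ)
    (hL : IsSubMarkovGenerator L) (hζ : HasFiniteLifetime L) {m : X → ℝ} (hm : ∀ x, 0 < m x)
    {s : X → ℝ} (hs : 0 ≤ s) (x y : X) :
    ∫⁻ p, ENNReal.ofReal (laplaceKernel m s (localTime m ξ p.1 p.2)) ∂(pathMeasure m P ξ x y) =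
      ENNReal.ofReal ((m y)⁻¹ * resolvent L s x y) := by
  have := h.isProbabilityMeasure x
  have hS := h.measurableSet_graph y
  have hker : Measurable fun p : Ω × ℝ =>
      ENNReal.ofReal (laplaceKernel m s (localTime m ξ p.1 p.2)) :=
    ((measurable_laplaceKernel m s).comp (h.measurable_localTime m)).ennreal_ofReal
  have heq : ∀ ω t, laplaceKernel m s (localTime m ξ ω t) = Real.exp
      (-∑ u, s u * volume.real {r : ℝ | 0 ≤ r ∧ r ≤ t ∧ ξ r ω = some u}) := fun ω t => by
    unfold laplaceKernel localTime
    congr 2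
    refine Finset.sum_congr rfl fun u _ => ?_
    rw [Real.coe_toNNReal _ (mul_nonneg (inv_pos.mpr (hm u)).le measureReal_nonneg)]
    have := (hm u).ne'
    field_simp
  rw [pathMeasure, lintegral_smul_measure, ← lintegral_indicator hS,
    lintegral_prod_symm' _ (hker.indicator hS), ← lintegral_add_compl _ measurableSet_Ioi (A := Set.Ioi (0 : ℝ)),
    smul_eq_mul, ENNReal.ofReal_mul (inv_pos.mpr (hm y)).le]
  congr 1
  -- Negative times are excluded by the indicator, and `t = 0` is a null set.
  have hneg : ∫⁻ t in (Set.Ioi (0 : ℝ))ᶜ, ∫⁻ ω, {p : Ω × ℝ | 0 ≤ p.2 ∧ ξ p.2 p.1 = some y}.indicator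
      (fun p => ENNReal.ofReal (laplaceKernel m s (localTime m ξ p.1 p.2))) (ω, t) ∂(P x) = 0 := by
    rw [Set.compl_Ioi, ← setLIntegral_congr Iio_ae_eq_Iic, setLIntegral_congr_fun (g := fun _ => 0)
      measurableSet_Iio, lintegral_zero]
    intro t ht
    simp only
    rw [← lintegral_zero (μ := P x)]
    refine lintegral_congr fun ω => Set.indicator_of_notMem (fun hmem => ?_) _
    exact absurd hmem.1 (not_le.mpr ht)
  have hpos : ∫⁻ t in Set.Ioi (0 : ℝ), ∫⁻ ω, {p : Ω × ℝ | 0 ≤ p.2 ∧ ξ p.2 p.1 = some y}.indicator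
      (fun p => ENNReal.ofReal (laplaceKernel m s (localTime m ξ p.1 p.2))) (ω, t) ∂(P x) =
      ∫⁻ t in Set.Ioi (0 : ℝ), ENNReal.ofReal (semigroup (L - Matrix.diagonal s) t x y) := by
    refine setLIntegral_congr_fun measurableSet_Ioi fun t (ht : 0 < t) => ?_
    rw [← h.lintegral_exp_occupation hL hs ht x y,
      ← lintegral_indicator (h.measurableSet_eq t ht.le y)]
    refine lintegral_congr fun ω => ?_
    by_cases hω : ξ t ω = some y
    · rw [Set.indicator_of_mem (show (ω, t) ∈ {p : Ω × ℝ | 0 ≤ p.2 ∧ ξ p.2 p.1 = some y} from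
        ⟨ht.le, hω⟩), Set.indicator_of_mem (show ω ∈ {ω | ξ t ω = some y} from hω), heq]
    · rw [Set.indicator_of_notMem (fun hmem => hω hmem.2),
        Set.indicator_of_notMem (show ω ∉ {ω | ξ t ω = some y} from hω)]
  obtain ⟨hi, hv⟩ := integral_semigroup_sub_diagonal hL hζ hs x y
  rw [hneg, hpos, add_zero, ← hv, ofReal_integral_eq_lintegral_ofReal hi]
  exact (ae_restrict_iff' measurableSet_Ioi).mpr (ae_of_all _ fun t ht =>
    (semigroup_sub_diagonal_le hL hs (le_of_lt ht) x y).1)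

end IsMarkovProcess

end Dynkin

end

noncomputable section

namespace Dynkin

open scoped ENNReal

/-! ### The law `Q`, its convolution roots and its size-biased version. -/

section Law

variable {X : Type*} [Fintype X] [DecidableEq X] {L : Matrix X X ℝ} {m : X → ℝ}

lemma laplaceTransform_zero {X : Type*} [Fintype X] (m : X → ℝ) (M : Measure (X → ℝ≥0)) :
    laplaceTransform m M 0 = M Set.univ := by
  simp [laplaceTransform]

/-- The total mass is the transform at `0`, a nonnegative n-th root of `Φ(0) = 1`. -/
lemma exists_isProbabilityMeasure_laplaceTransform_pow (hm : ∀ x, 0 < m x)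
    (hL : IsSubMarkovGenerator L) (hζ : HasFiniteLifetime L) {n : ℕ} (hn : 0 < n) :
    ∃ R : Measure (X → ℝ≥0), IsProbabilityMeasure R ∧
      ∀ s, 0 ≤ s → laplaceTransform m R s ^ n = ENNReal.ofReal (laplaceRatio L s) := by
  obtain ⟨χ, ⟨h0, R, -, hR⟩, hχ⟩ := exists_isLaplace_pow_eq hm hL hζ hn
  refine ⟨R, ⟨?_⟩, fun s hs => ?_⟩
  · rw [← laplaceTransform_zero m, hR 0 le_rfl]
    have h1 : χ 0 ^ n = 1 := (hχ 0 le_rfl).trans (laplaceRatio_zero hL hζ)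
    rw [(pow_eq_one_iff_of_nonneg (h0 0 le_rfl) hn.ne').mp h1, ENNReal.ofReal_one]
  · rw [hR s hs, ← hχ s hs, ENNReal.ofReal_pow (h0 s hs)]

lemma laplaceKernel_sum {X ι : Type*} [Fintype X] (t : Finset ι) (m s : X → ℝ) (v : ι → X → ℝ≥0) :
    laplaceKernel m s (∑ i ∈ t, v i) = ∏ i ∈ t, laplaceKernel m s (v i) := by
  classical
  induction t using Finset.induction_on with
  | empty => simp
  | insert i t hi ih => rw [Finset.sum_insert hi, Finset.prod_insert hi, laplaceKernel_add_right, ih]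

lemma laplaceTransform_map_sum {X : Type*} [Fintype X] {m : X → ℝ} (hm : ∀ x, 0 < m x) (R : Measure (X → ℝ≥0)) [IsFiniteMeasure R]
    (n : ℕ) {s : X → ℝ} (hs : 0 ≤ s) :
    laplaceTransform m ((Measure.pi fun _ : Fin n => R).map fun v => ∑ i, v i) s =
      laplaceTransform m R s ^ n := by
  have hmeas : Measurable fun v : Fin n → X → ℝ≥0 => ∑ i, v i := by fun_prop
  rw [← ENNReal.toReal_eq_toReal_iff' (laplaceTransform_ne_top hm hs _)
    (ENNReal.pow_ne_top (laplaceTransform_ne_top hm hs _)), ENNReal.toReal_pow,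
    ← integral_laplaceKernel, ← integral_laplaceKernel,
    integral_map hmeas.aemeasurable (by fun_prop)]
  simp only [laplaceKernel_sum]
  rw [integral_fintype_prod_eq_prod (f := fun _ => laplaceKernel m s)]
  simp

lemma isInfinitelyDivisible_of_laplaceTransform (hm : ∀ x, 0 < m x)
    (hL : IsSubMarkovGenerator L) (hζ : HasFiniteLifetime L) {Q : Measure (X → ℝ≥0)}
    [IsProbabilityMeasure Q]
    (hQ : ∀ s, 0 ≤ s → laplaceTransform m Q s = ENNReal.ofReal (laplaceRatio L s)) :
    IsInfinitelyDivisible Q := by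
  intro n hn
  obtain ⟨R, hR, hRn⟩ := exists_isProbabilityMeasure_laplaceTransform_pow hm hL hζ hn
  refine ⟨R, hR, ext_of_laplaceTransform hm fun s hs => ?_⟩
  rw [laplaceTransform_map_sum hm R n hs, hRn s hs, hQ s hs]

/-- The Laplace transform of the measure `ρ_x Q(dρ)`. -/
lemma lintegral_mul_laplaceKernel (hm : ∀ x, 0 < m x)
    (hL : IsSubMarkovGenerator L) (hζ : HasFiniteLifetime L) {Q : Measure (X → ℝ≥0)}
    [IsProbabilityMeasure Q]
    (hQ : ∀ s, 0 ≤ s → laplaceTransform m Q s = ENNReal.ofReal (laplaceRatio L s))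
    (x : X) {s : X → ℝ} (hs : 0 ≤ s) :
    ∫⁻ ρ, (ρ x : ℝ≥0∞) * ENNReal.ofReal (laplaceKernel m s ρ) ∂Q =
      ENNReal.ofReal (laplaceRatio L s) * ENNReal.ofReal ((m x)⁻¹ * resolvent L s x x) := by
  set v : X → ℝ := Pi.single x 1 with hv
  have hv0 : 0 ≤ v := Pi.single_nonneg.mpr zero_le_one
  obtain ⟨u, -, hu0, hu⟩ := exists_seq_strictAnti_tendsto' (zero_lt_one (α := ℝ))
  have hu' : Tendsto u atTop (𝓝[>] 0) :=
    tendsto_nhdsWithin_iff.mpr ⟨hu, Eventually.of_forall fun n => (hu0 n).1⟩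
  -- Minus the difference quotient of the kernel in the direction of `x`, divided by `m x`. It
  -- converges to `ρ x * laplaceKernel m s ρ` and, by convexity of the exponential, stays below it.
  set D : ℕ → (X → ℝ≥0) → ℝ := fun n ρ =>
    (m x)⁻¹ * ((u n)⁻¹ * (laplaceKernel m s ρ - laplaceKernel m (s + u n • v) ρ)) with hD
  have hsn : ∀ n, 0 ≤ s + u n • v := fun n => add_nonneg hs (smul_nonneg (hu0 n).1.le hv0)
  have hker : ∀ (h : ℝ) (ρ : X → ℝ≥0), laplaceKernel m (s + h • v) ρ =
      laplaceKernel m s ρ * Real.exp (-(h * (ρ x * m x))) := fun h ρ => by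
    rw [laplaceKernel_add_left]
    congr 1
    unfold laplaceKernel
    congr 2
    rw [Finset.sum_eq_single x (fun z _ hz => by simp [hv, hz]) (by simp)]
    simp [hv, mul_assoc]
  have hDlim : ∀ ρ, Tendsto (fun n => D n ρ) atTop (𝓝 (ρ x * laplaceKernel m s ρ)) := fun ρ => by
    have h1 : HasDerivAt (fun h : ℝ => laplaceKernel m (s + h • v) ρ)
        (-(laplaceKernel m s ρ * (ρ x * m x))) 0 := by
      simp only [hker]
      have := (((hasDerivAt_id (0 : ℝ)).mul_const (ρ x * m x : ℝ)).neg.exp).const_mul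
        (laplaceKernel m s ρ)
      convert! this using 1
      simp
    have h2 := (h1.tendsto_slope_zero_right.comp hu').const_mul (-(m x)⁻¹)
    convert! h2 using 1
    · funext n
      simp [hD]
      ring
    · have := (hm x).ne'
      congr 1
      field_simp
  have hDle : ∀ n ρ, D n ρ ≤ ρ x * laplaceKernel m s ρ := fun n ρ => by
    have hc := Real.add_one_le_exp (-(u n * (ρ x * m x)))
    have h1 : laplaceKernel m s ρ - laplaceKernel m (s + u n • v) ρ ≤
        laplaceKernel m s ρ * (u n * (ρ x * m x)) := by
      rw [hker]
      have := mul_le_mul_of_nonneg_left hc (laplaceKernel_pos m s ρ).le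
      linarith
    have h2 : (m x)⁻¹ * ((u n)⁻¹ * (laplaceKernel m s ρ * (u n * (ρ x * m x)))) =
        ρ x * laplaceKernel m s ρ := by
      have := (hm x).ne'
      have := (hu0 n).1.ne'
      field_simp
    rw [← h2]
    exact mul_le_mul_of_nonneg_left (mul_le_mul_of_nonneg_left h1 (inv_pos.mpr (hu0 n).1).le)
      (inv_pos.mpr (hm x)).le
  have hD0 : ∀ n ρ, 0 ≤ D n ρ := fun n ρ => by
    refine mul_nonneg (inv_pos.mpr (hm x)).le (mul_nonneg (inv_pos.mpr (hu0 n).1).le ?_)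
    rw [hker, sub_nonneg]
    refine mul_le_of_le_one_right (laplaceKernel_pos m s ρ).le (Real.exp_le_one_iff.mpr ?_)
    exact neg_nonpos.mpr (mul_nonneg (hu0 n).1.le (mul_nonneg (ρ x).coe_nonneg (hm x).le))
  have hDm : ∀ n, Measurable (D n) := fun n => by
    simp only [hD]
    fun_prop
  have hphi : ∀ s, 0 ≤ s → ∫ ρ, laplaceKernel m s ρ ∂Q = laplaceRatio L s := fun s hs => by
    rw [integral_laplaceKernel, hQ s hs, ENNReal.toReal_ofReal (laplaceRatio_pos hL hζ hs).le]
  have hDint : ∀ n, ∫⁻ ρ, ENNReal.ofReal (D n ρ) ∂Q = ENNReal.ofReal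
      ((m x)⁻¹ * ((u n)⁻¹ * (laplaceRatio L s - laplaceRatio L (s + u n • v)))) := fun n => by
    have hi1 := integrable_laplaceKernel hm hs Q
    have hi2 := integrable_laplaceKernel hm (hsn n) Q
    have hDi : Integrable (D n) Q := ((hi1.sub hi2).const_mul _).const_mul _
    rw [← ofReal_integral_eq_lintegral_ofReal hDi (ae_of_all _ (hD0 n))]
    simp only [hD]
    rw [integral_const_mul, integral_const_mul, integral_sub hi1 hi2, hphi s hs,
      hphi _ (hsn n)]
  have hlim : Tendsto (fun n => ∫⁻ ρ, ENNReal.ofReal (D n ρ) ∂Q) atTop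
      (𝓝 (ENNReal.ofReal (laplaceRatio L s * ((m x)⁻¹ * resolvent L s x x)))) := by
    simp only [hDint]
    refine (ENNReal.continuous_ofReal.tendsto _).comp ?_
    have h1 := hasDerivAt_laplaceRatio (isUnit_det_neg_add_diagonal hL hζ hs) v
    have h2 := (h1.tendsto_slope_zero_right.comp hu').const_mul (-(m x)⁻¹)
    convert! h2 using 1
    · funext n
      simp
      ring
    · rw [Finset.sum_eq_single x (fun z _ hz => by simp [hv, hz]) (by simp)]
      simp only [hv, Pi.single_eq_same]
      congr 1
      ring
  rw [← ENNReal.ofReal_mul (laplaceRatio_pos hL hζ hs).le]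
  have hlhs : ∫⁻ ρ, (ρ x : ℝ≥0∞) * ENNReal.ofReal (laplaceKernel m s ρ) ∂Q =
      ∫⁻ ρ, ENNReal.ofReal (ρ x * laplaceKernel m s ρ) ∂Q :=
    lintegral_congr fun ρ => by
      rw [ENNReal.ofReal_mul (ρ x).coe_nonneg, ENNReal.ofReal_coe_nnreal]
  rw [hlhs]
  -- Fatou gives one inequality and the pointwise upper bound the other, so integrability of `ρ x`
  -- is not needed in advance.
  refine le_antisymm ?_ ?_
  · have hpt : ∀ ρ, ENNReal.ofReal (ρ x * laplaceKernel m s ρ) =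
        liminf (fun n => ENNReal.ofReal (D n ρ)) atTop := fun ρ =>
      (((ENNReal.continuous_ofReal.tendsto _).comp (hDlim ρ)).liminf_eq).symm
    simp only [hpt]
    refine (lintegral_liminf_le fun n => (hDm n).ennreal_ofReal).trans ?_
    rw [hlim.liminf_eq]
  · exact le_of_tendsto hlim (Eventually.of_forall fun n =>
      lintegral_mono fun ρ => ENNReal.ofReal_le_ofReal (hDle n ρ))

/-- The measure `ρ_x Q(dρ)` is the image of `Q ⊗ 𝔼_{x,x}` under `(ρ, l) ↦ l + ρ`. -/
theorem withDensity_eq_map_localTime_add (hm : ∀ x, 0 < m x)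
    (hL : IsSubMarkovGenerator L) (hζ : HasFiniteLifetime L) {Q : Measure (X → ℝ≥0)}
    [IsProbabilityMeasure Q]
    (hQ : ∀ s, 0 ≤ s → laplaceTransform m Q s = ENNReal.ofReal (laplaceRatio L s))
    {Ω : Type*} [MeasurableSpace Ω] {P : X → Measure Ω} {ξ : ℝ → Ω → Option X}
    (h : IsMarkovProcess L P ξ) (x : X) :
    Q.withDensity (fun ρ => (ρ x : ℝ≥0∞)) =
      (Q.prod (pathMeasure m P ξ x x)).map fun w => localTime m ξ w.2.1 w.2.2 + w.1 := by
  have := h.isProbabilityMeasure x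
  have hsf : SFinite (pathMeasure m P ξ x x) := by unfold pathMeasure; infer_instance
  have hT : Measurable fun w : (X → ℝ≥0) × (Ω × ℝ) => localTime m ξ w.2.1 w.2.2 + w.1 :=
    ((h.measurable_localTime m).comp measurable_snd).add measurable_fst
  have hleft : ∀ s, 0 ≤ s → laplaceTransform m (Q.withDensity fun ρ => (ρ x : ℝ≥0∞)) s =
      ENNReal.ofReal (laplaceRatio L s) * ENNReal.ofReal ((m x)⁻¹ * resolvent L s x x) :=
    fun s hs => by
      rw [laplaceTransform, lintegral_withDensity_eq_lintegral_mul _ (by fun_prop) (by fun_prop)]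
      exact lintegral_mul_laplaceKernel hm hL hζ hQ x hs
  have hright : ∀ s, 0 ≤ s → laplaceTransform m ((Q.prod (pathMeasure m P ξ x x)).map
      fun w => localTime m ξ w.2.1 w.2.2 + w.1) s =
      ENNReal.ofReal (laplaceRatio L s) * ENNReal.ofReal ((m x)⁻¹ * resolvent L s x x) :=
    fun s hs => by
      have hl : Measurable fun p : Ω × ℝ =>
          ENNReal.ofReal (laplaceKernel m s (localTime m ξ p.1 p.2)) :=
        ((measurable_laplaceKernel m s).comp (h.measurable_localTime m)).ennreal_ofReal
      rw [laplaceTransform, lintegral_map (by fun_prop) hT]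
      simp only [laplaceKernel_add_right, ENNReal.ofReal_mul (laplaceKernel_pos _ _ _).le]
      simp only [mul_comm (ENNReal.ofReal (laplaceKernel m s (localTime _ _ _ _)))]
      rw [lintegral_prod_mul (f := fun ρ => ENNReal.ofReal (laplaceKernel m s ρ))
        (g := fun p : Ω × ℝ => ENNReal.ofReal (laplaceKernel m s (localTime m ξ p.1 p.2)))
        (by fun_prop) hl.aemeasurable, h.lintegral_laplaceKernel_localTime hL hζ hm hs x x]
      congr 1
      exact hQ s hs
  -- Uniqueness requires finite measures; finiteness of both sides is read off from their transforms
  -- at `s = 0`.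
  have hf1 : IsFiniteMeasure (Q.withDensity fun ρ => (ρ x : ℝ≥0∞)) := ⟨by
    rw [← laplaceTransform_zero m, hleft 0 le_rfl]
    exact ENNReal.mul_lt_top ENNReal.ofReal_lt_top ENNReal.ofReal_lt_top⟩
  have hf2 : IsFiniteMeasure ((Q.prod (pathMeasure m P ξ x x)).map
      fun w => localTime m ξ w.2.1 w.2.2 + w.1) := ⟨by
    rw [← laplaceTransform_zero m, hright 0 le_rfl]
    exact ENNReal.mul_lt_top ENNReal.ofReal_lt_top ENNReal.ofReal_lt_top⟩
  exact ext_of_laplaceTransform hm fun s hs => (hleft s hs).trans (hright s hs).symm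

end Law

end Dynkin

end

/-! ### Assembly of the theorem. -/

theorem corollary2 {X : Type*} [Fintype X] [DecidableEq X]
    (L : Matrix X X ℝ) (hL : IsSubMarkovGenerator L) (hζ : HasFiniteLifetime L)
    (μ : X → ℝ) (hμ : ∀ x, 0 ≤ μ x) (hμ1 : ∑ x, μ x = 1)
    (hreach : ∀ x, ∃ y, 0 < μ y ∧ Reaches L y x)
    (m : X → ℝ) (hm : m = refMeasure L μ) :
    ∃ Q : Measure (X → ℝ≥0),
      IsProbabilityMeasure Q ∧
      (∀ B : Set (X → ℝ≥0), MeasurableSet B →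
        (twistedGaussian L m).map halfSq B = ((Q.real B : ℝ) : ℂ)) ∧
      IsInfinitelyDivisible Q ∧
      (∀ s : X → ℝ, 0 ≤ s →
        ∫ ρ, Real.exp (-∑ x, s x * (ρ x : ℝ) * m x) ∂Q = laplaceRatio L s) ∧
      IsCompletelyMonotone (laplaceRatio L) ∧
      ∀ (Ω : Type*) [MeasurableSpace Ω] (P : X → Measure Ω) (ξ : ℝ → Ω → Option X),
        IsMarkovProcess L P ξ → ∀ x : X,
          (∀ F : (X → ℝ≥0) → ℝ≥0, Continuous F →
            ∫⁻ ρ, ((ρ x * F ρ : ℝ≥0) : ENNReal) ∂Q =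
              ∫⁻ ρ, ∫⁻ p, (F (localTime m ξ p.1 p.2 + ρ) : ENNReal)
                ∂(pathMeasure m P ξ x x) ∂Q) ∧
          (∀ F : (X → ℝ≥0) → ℂ, Continuous F →
            (Integrable (fun ρ => ((ρ x : ℝ) : ℂ) * F ρ) Q ↔
              Integrable (fun w : (X → ℝ≥0) × (Ω × ℝ) =>
                F (localTime m ξ w.2.1 w.2.2 + w.1)) (Q.prod (pathMeasure m P ξ x x))) ∧
            (Integrable (fun ρ => ((ρ x : ℝ) : ℂ) * F ρ) Q →
              ∫ ρ, ((ρ x : ℝ) : ℂ) * F ρ ∂Q =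
                ∫ ρ, ∫ p, F (localTime m ξ p.1 p.2 + ρ) ∂(pathMeasure m P ξ x x) ∂Q)) := by
  have hmpos : ∀ x, 0 < m x := fun x => hm ▸ refMeasure_pos hL hζ hμ hreach x
  have hmL : Matrix.vecMul m L = -μ := hm ▸ vecMul_refMeasure hL hζ
  -- `Q` is the first root of `Φ`, constructed independently of the Gaussian and identified with its
  -- image afterwards.
  obtain ⟨Q, hQprob, hQ⟩ := exists_isProbabilityMeasure_laplaceTransform_pow hmpos hL hζ one_pos
  simp only [pow_one] at hQ
  have hQint : ∀ s : X → ℝ, 0 ≤ s → ∫ ρ, laplaceKernel m s ρ ∂Q = laplaceRatio L s := fun s hs => by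
    rw [integral_laplaceKernel, hQ s hs, ENNReal.toReal_ofReal (laplaceRatio_pos hL hζ hs).le]
  have hgauss := fun (s : X → ℝ) (hs : 0 ≤ s) =>
    integral_twistedGaussianDensity_mul hL hζ hμ hreach hmpos hmL hs
  have hint : Integrable (twistedGaussianDensity L m) := by
    simpa using (hgauss 0 le_rfl).1
  refine ⟨Q, hQprob, fun B hB => ?_, isInfinitelyDivisible_of_laplaceTransform hmpos hL hζ hQ,
    hQint, IsResolventPolynomial.laplaceRatio.isCompletelyMonotone hL hζ, ?_⟩
  · rw [VectorMeasure.map_apply _ measurable_halfSq hB, twistedGaussian,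
      withDensityᵥ_apply hint (measurable_halfSq hB)]
    refine setIntegral_preimage_eq_of_laplace_complex hmpos measurable_halfSq hint
      (fun s hs => ?_) hB
    rw [(hgauss s hs).2, hQint s hs]
  · intro Ω _ P ξ h x
    have := h.isProbabilityMeasure x
    have hsf : SFinite (pathMeasure m P ξ x x) := by unfold pathMeasure; infer_instance
    have hT : Measurable fun w : (X → ℝ≥0) × (Ω × ℝ) => localTime m ξ w.2.1 w.2.2 + w.1 :=
      ((h.measurable_localTime m).comp measurable_snd).add measurable_fst
    have hρ : Measurable fun ρ : X → ℝ≥0 => ρ x := by fun_prop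
    -- An equality of measures: integrating `F` against both sides yields the nonnegative case, the
    -- equivalence of integrability and the complex case.
    have key := withDensity_eq_map_localTime_add hmpos hL hζ hQ h x
    refine ⟨fun F hF => ?_, fun F hF => ?_⟩
    · have hFm : Measurable fun ρ => (F ρ : ENNReal) := hF.measurable.coe_nnreal_ennreal
      have hFT : AEMeasurable (fun w : (X → ℝ≥0) × (Ω × ℝ) =>
          (F (localTime m ξ w.2.1 w.2.2 + w.1) : ENNReal)) (Q.prod (pathMeasure m P ξ x x)) :=
        (hFm.comp hT).aemeasurable
      have h1 := congrArg (fun M => ∫⁻ ρ, (F ρ : ENNReal) ∂M) key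
      rw [lintegral_withDensity_eq_lintegral_mul _ (by fun_prop) hFm, lintegral_map hFm hT,
        lintegral_prod _ hFT] at h1
      simp only [ENNReal.coe_mul]
      exact h1
    · have hmul : ∀ ρ : X → ℝ≥0, ((ρ x : ℝ) : ℂ) * F ρ = ρ x • F ρ := fun ρ => by
        rw [NNReal.smul_def, Complex.real_smul]
      have hiff : Integrable (fun ρ => ((ρ x : ℝ) : ℂ) * F ρ) Q ↔
          Integrable (fun w : (X → ℝ≥0) × (Ω × ℝ) => F (localTime m ξ w.2.1 w.2.2 + w.1))
            (Q.prod (pathMeasure m P ξ x x)) := by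
        simp only [hmul]
        rw [← integrable_withDensity_iff_integrable_smul hρ, key,
          integrable_map_measure hF.aestronglyMeasurable hT.aemeasurable]
        rfl
      refine ⟨hiff, fun hi => ?_⟩
      have h1 := congrArg (fun M => ∫ ρ, F ρ ∂M) key
      rw [integral_withDensity_eq_integral_smul hρ,
        integral_map hT.aemeasurable hF.aestronglyMeasurable, integral_prod _ (hiff.mp hi)] at h1
      simp only [hmul]
      exact h1
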